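/- Let $d_{\mathrm h}, d_{\mathrm p} \ge 1$ be integers, $d = d_{\mathrm h} + d_{\mathrm p}$, and $\mathbb T = \mathbb R/2\pi\mathbb Z$. Let $A, B, K$ be real $d\times d$ matrices, written by blocks according to the decomposition $d = d_{\mathrm h}+d_{\mathrm p}$, with \[ B = \begin{pmatrix} 0 & 0\\ 0 & D\end{pmatrix}, \qquad A = \begin{pmatrix} A' & A_{12}\\ A_{21} & A_{22}\end{pmatrix}. \] Assume that every complex eigenvalue of $D$ has positive real part, and that $A'$ is diagonalizable with only real eigenvalues. Let $\mathcal L$ be the unbounded operator on $L^2(\mathbb T)^d$ (complex-valued functions) with domain $H^1(\mathbb T)^{d_{\mathrm h}} \times H^2(\mathbb T)^{d_{\mathrm p}}$ defined by $\mathcal L f = -B\partial_x^2 f + A\partial_x f + K f$. Then there is exactly one strongly continuous semigroup $(\mathrm e^{-t\mathcal L})_{t\ge 0}$ of bounded operators on $L^2(\mathbb T)^d$ whose generator is the closure of $-\mathcal L$, and it has the following properties. 1. For every $f_0 \in H^1(\mathbb T)^{d_{\mathrm h}} \times L^2(\mathbb T)^{d_{\mathrm p}}$ and every $t > 0$, $\mathrm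 e^{-t\mathcal L} f_0 \in H^1(\mathbb T)^d$. 2. If moreover $A_{12} = 0$, then for every $f_0 \in H^2(\mathbb T)^{d_{\mathrm h}} \times L^2(\mathbb T)^{d_{\mathrm p}}$ and every $t > 0$, $\mathrm e^{-t\mathcal L} f_0 \in H^2(\mathbb T)^d$. -/

import Mathlib

open MeasureTheory Filter Topology
open scoped NNReal ContDiff

noncomputable section

namespace ParabolicTransport

instance two_pi_fact : Fact (0 < 2 * Real.pi) := ⟨Real.two_pi_pos⟩

/-- The torus `ℝ / 2πℤ`. -/
abbrev Torus : Type := AddCircle (2 * Real.pi)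

/-- Complex-valued `L²` functions on the torus. The measure is the invariant measure of total
mass one, i.e. Lebesgue measure divided by `2π`. -/
abbrev L2T : Type := Lp ℂ 2 (AddCircle.haarAddCircle : Measure Torus)

/-- `g` is the weak derivative of `f`: `∫ f φ' = - ∫ g φ` for every smooth `φ` on the torus. Here
`ψ` is the derivative of `φ`. -/
def IsWeakDeriv (f g : L2T) : Prop :=
  ∀ φ ψ : Torus → ℂ, ContDiff ℝ ∞ (fun x : ℝ => φ (x : Torus)) →
    (∀ x : ℝ, HasDerivAt (fun y : ℝ => φ (y : Torus)) (ψ (x : Torus)) x) →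
      ∫ x, f x * ψ x ∂AddCircle.haarAddCircle = - ∫ x, g x * φ x ∂AddCircle.haarAddCircle

/-- Membership in the Sobolev space `H^k` of the torus: `f` has `k` successive weak derivatives
in `L²`. -/
def MemH : ℕ → L2T → Prop
  | 0, _ => True
  | k + 1, f => ∃ g, IsWeakDeriv f g ∧ MemH k g

theorem IsWeakDeriv.fourierCoeff_eq {f g : L2T} (h : IsWeakDeriv f g) (n : ℤ) :
    fourierCoeff g n = Complex.I * n * fourierCoeff f n := by
  have hd : ∀ x : ℝ, HasDerivAt (fun y : ℝ => (fourier (-n) (y : Torus) : ℂ))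
      ((fun z : Torus => -(Complex.I * n) * fourier (-n) z) (x : Torus)) x := by
    intro x
    have := hasDerivAt_fourier_neg (2 * Real.pi) n x
    convert this using 1
    have hpi : (Real.pi : ℂ) ≠ 0 := by exact_mod_cast Real.pi_ne_zero
    push_cast
    field_simp
  have hs : ContDiff ℝ ∞ (fun x : ℝ => (fourier (-n) (x : Torus) : ℂ)) := by
    simp only [fourier_coe_apply]
    have h1 : ContDiff ℝ ∞ (fun x : ℝ => (x : ℂ)) := Complex.ofRealCLM.contDiff
    fun_prop
  have key := h _ (fun z : Torus => -(Complex.I * n) * fourier (-n) z) hs hd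
  have e1 : ∫ x, f x * (-(Complex.I * n) * fourier (-n) x) ∂AddCircle.haarAddCircle
      = -(Complex.I * n) * fourierCoeff f n := by
    rw [fourierCoeff, ← integral_const_mul]
    congr 1
    ext x
    simp only [smul_eq_mul]
    ring
  have e2 : ∫ x, g x * fourier (-n) x ∂AddCircle.haarAddCircle = fourierCoeff g n := by
    rw [fourierCoeff]
    congr 1
    ext x
    simp only [smul_eq_mul]
    ring
  rw [e1, e2] at key
  linear_combination key

theorem IsWeakDeriv.unique {f g₁ g₂ : L2T} (h₁ : IsWeakDeriv f g₁) (h₂ : IsWeakDeriv f g₂) :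
    g₁ = g₂ := by
  apply (fourierBasis (T := 2 * Real.pi)).repr.injective
  ext n
  rw [fourierBasis_repr, fourierBasis_repr, h₁.fourierCoeff_eq, h₂.fourierCoeff_eq]

open Classical in
/-- The weak derivative `∂ₓ f`, for `f` in `H¹` (and `0` for other `f`). -/
def weakDeriv (f : L2T) : L2T := if h : ∃ g, IsWeakDeriv f g then h.choose else 0

theorem IsWeakDeriv.weakDeriv_eq {f g : L2T} (h : IsWeakDeriv f g) : weakDeriv f = g := by
  have hex : ∃ g, IsWeakDeriv f g := ⟨g, h⟩
  rw [weakDeriv, dif_pos hex]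
  exact hex.choose_spec.unique h

/-- A strongly continuous one-parameter semigroup of bounded operators. -/
structure IsC0Semigroup {X : Type*} [NormedAddCommGroup X] [NormedSpace ℂ X]
    (S : ℝ≥0 → X →L[ℂ] X) : Prop where
  map_zero : S 0 = ContinuousLinearMap.id ℂ X
  map_add : ∀ s t, S (s + t) = (S s).comp (S t)
  continuous_orbit : ∀ x, Continuous fun t => S t x

/-- The graph of the infinitesimal generator: the pairs `(x, y)` with
`(S t x - x) / t → y` as `t → 0⁺`. -/
def generatorGraph {X : Type*} [NormedAddCommGroup X] [NormedSpace ℂ X]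
    (S : ℝ≥0 → X →L[ℂ] X) : Set (X × X) :=
  {p | Tendsto (fun t : ℝ≥0 => (((t : ℝ) : ℂ)⁻¹) • (S t p.1 - p.1)) (𝓝[>] 0) (𝓝 p.2)}

/-- The state space `L²(𝕋)^d`, `d = dh + dp`; the first `dh` components are the hyperbolic ones
and the last `dp` components are the parabolic ones. -/
abbrev State (dh dp : ℕ) : Type := Fin dh ⊕ Fin dp → L2T

/-- The space `H^k(𝕋)^dh × H^l(𝕋)^dp`. -/
def sobolev (dh dp k l : ℕ) : Set (State dh dp) :=
  {f | (∀ i, MemH k (f (Sum.inl i))) ∧ ∀ j, MemH l (f (Sum.inr j))}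

/-- The expression `ℒ f = -B ∂ₓ² f + A ∂ₓ f + K f`. -/
def opL {dh dp : ℕ} (A B K : Matrix (Fin dh ⊕ Fin dp) (Fin dh ⊕ Fin dp) ℝ)
    (f : State dh dp) : State dh dp := fun i =>
  -(∑ j, B i j • weakDeriv (weakDeriv (f j))) + ∑ j, A i j • weakDeriv (f j) + ∑ j, K i j • f j

/-- The graph of the unbounded operator `-ℒ` with domain `H¹(𝕋)^dh × H²(𝕋)^dp`. -/
def negLGraph {dh dp : ℕ} (A B K : Matrix (Fin dh ⊕ Fin dp) (Fin dh ⊕ Fin dp) ℝ) :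
    Set (State dh dp × State dh dp) :=
  {p | p.1 ∈ sobolev dh dp 1 2 ∧ p.2 = -opL A B K p.1}

/-- `S t = e^{-tℒ}`: `S` is a strongly continuous semigroup on `L²(𝕋)^d` whose generator is the
closure of `-ℒ`. (The closure cannot be omitted: `ℒ` with domain `H¹(𝕋)^dh × H²(𝕋)^dp` need not
be a closed operator when `0` is an eigenvalue of the hyperbolic block of `A`.) -/
def IsFreeSemigroup {dh dp : ℕ} (A B K : Matrix (Fin dh ⊕ Fin dp) (Fin dh ⊕ Fin dp) ℝ)
    (S : ℝ≥0 → State dh dp →L[ℂ] State dh dp) : Prop :=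
  IsC0Semigroup S ∧ generatorGraph S = closure (negLGraph A B K)

/-- A square matrix is diagonalizable over the field of its coefficients. -/
def IsDiagonalizable {n : ℕ} {F : Type*} [Field F] (M : Matrix (Fin n) (Fin n) F) : Prop :=
  ∃ P : Matrix (Fin n) (Fin n) F, IsUnit P.det ∧
    ∃ v : Fin n → F, M = P * Matrix.diagonal v * P⁻¹

/-- A real matrix, seen as a complex matrix. -/
def toComplex {n : ℕ} (M : Matrix (Fin n) (Fin n) ℝ) : Matrix (Fin n) (Fin n) ℂ :=
  M.map (algebraMap ℝ ℂ)

end ParabolicTransport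

end

noncomputable section

namespace ParabolicTransport

/-!
Fourier series turn `-ℒ` into the multiplier with matrices `G n = -(n² B + i n A + K)`, and the
closure of `-ℒ` is this multiplier on its maximal domain. Hence the semigroup, if it exists, is the
multiplier with matrices `exp (t • G n)`, and it exists as soon as these are bounded uniformly in
`n` and in `t` from bounded intervals.

Choose inner products in which `A'` is symmetric and `D` is accretive. In the resulting energy
estimates the damped part `p` of a solution of `u' = G n u` decays like `exp (-c n² t)` up to a
forcing of size `O(|n|)` by the transported part `h`, while `h` is forced by `p` only at rate
`β |n| + O(1)`, with `β = 0` if `A₁₂ = 0`. The forcing of `h` by the initial value of `p` thus lasts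
for a time of order `n⁻²`, which gives
`‖exp (t • G n) x‖ ≤ C (‖h x‖ + |n|⁻ᵏ ‖p x‖) + C exp (-c n² t) ‖p x‖`
with `k = 1` in general and `k = 2` if `A₁₂ = 0`: this is the gain of `k` derivatives.
-/

/-! ### Coefficients with respect to a Hilbert basis -/

section HilbertBasis

variable {J 𝕜 H ι κ : Type*} [RCLike 𝕜] [NormedAddCommGroup H] [InnerProductSpace 𝕜 H]
  (b : HilbertBasis J 𝕜 H)

theorem hasSum_sq_norm_repr (f : H) : HasSum (fun n => ‖b.repr f n‖ ^ 2) (‖f‖ ^ 2) := by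
  simpa using lp.hasSum_norm (p := 2) (by norm_num) (b.repr f)

theorem exists_repr_eq {a : J → 𝕜} (ha : Summable fun n => ‖a n‖ ^ 2) :
    ∃ f : H, ∀ n, b.repr f n = a n := by
  have hmem : Memℓp a 2 := memℓp_gen (by simpa using ha)
  exact ⟨b.repr.symm ⟨a, hmem⟩, fun n => by rw [LinearIsometryEquiv.apply_symm_apply]⟩

theorem tendsto_of_repr {α : Type*} {l : Filter α} {u : α → H} {f : H} {c : J → ℝ}
    (hc : Summable c) (h : ∀ n, Tendsto (fun a => b.repr (u a) n) l (𝓝 (b.repr f n)))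
    (hbound : ∀ᶠ a in l, ∀ n, ‖b.repr (u a) n - b.repr f n‖ ^ 2 ≤ c n) : Tendsto u l (𝓝 f) := by
  have parseval (a : α) : ∑' n, ‖b.repr (u a) n - b.repr f n‖ ^ 2 = ‖u a - f‖ ^ 2 := by
    simpa only [map_sub, lp.coeFn_sub, Pi.sub_apply] using
      (hasSum_sq_norm_repr b (u a - f)).tsum_eq
  have key : Tendsto (fun a => ∑' n, ‖b.repr (u a) n - b.repr f n‖ ^ 2) l
      (𝓝 (∑' _ : J, (0 : ℝ))) := by
    refine tendsto_tsum_of_dominated_convergence hc (fun n => ?_) ?_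
    · simpa using ((h n).sub_const (b.repr f n)).norm.pow 2
    · simpa using hbound
  simp only [parseval, tsum_zero] at key
  rw [tendsto_iff_norm_sub_tendsto_zero]
  simpa [Real.sqrt_sq] using key.sqrt

/-- The `n`-th coefficient vector of a finite family of elements of a Hilbert space, with respect
to a Hilbert basis `b`. -/
def coeff (n : J) : (ι → H) →L[𝕜] (ι → 𝕜) :=
  ContinuousLinearMap.pi fun i => (innerSL 𝕜 (b n)).comp (ContinuousLinearMap.proj i)

theorem coeff_apply (n : J) (f : ι → H) (i : ι) : coeff b n f i = b.repr (f i) n :=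
  (b.repr_apply_apply (f i) n).symm

theorem ext_coeff {f g : ι → H} (h : ∀ n, coeff b n f = coeff b n g) : f = g := by
  funext i
  apply b.repr.injective
  ext n
  rw [← coeff_apply, ← coeff_apply, h]

/-- The projection of a family onto the span of the basis vectors with index in `s`. -/
def truncation (s : Finset J) (f : ι → H) : ι → H := fun i => ∑ n ∈ s, b.repr (f i) n • b n

theorem tendsto_truncation (f : ι → H) : Tendsto (fun s => truncation b s f) atTop (𝓝 f) :=
  tendsto_pi_nhds.2 fun i => b.hasSum_repr (f i)

theorem coeff_truncation [DecidableEq J] (s : Finset J) (f : ι → H) (n : J) :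
    coeff b n (truncation b s f) = if n ∈ s then coeff b n f else 0 := by
  ext i
  rw [coeff_apply, b.repr_apply_apply, truncation]
  simp only [inner_sum, inner_smul_right, orthonormal_iff_ite.1 b.orthonormal, mul_ite, mul_one,
    mul_zero, Finset.sum_ite_eq]
  split_ifs
  · rw [coeff_apply]
  · rfl

theorem sq_norm_le_sum_sq_norm [Fintype ι] (x : ι → 𝕜) : ‖x‖ ^ 2 ≤ ∑ i, ‖x i‖ ^ 2 := by
  refine (Real.le_sqrt (norm_nonneg _) (by positivity)).1
    ((pi_norm_le_iff_of_nonneg (Real.sqrt_nonneg _)).2 fun i => Real.le_sqrt_of_sq_le ?_)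
  exact Finset.single_le_sum (f := fun i => ‖x i‖ ^ 2) (fun _ _ => by positivity)
    (Finset.mem_univ i)

theorem summable_sq_mul_norm_map [Finite ι] {E : Type*} [SeminormedAddCommGroup E]
    [NormedSpace 𝕜 E] (L : (ι → 𝕜) →L[𝕜] E) {w : J → ℝ} {x : J → ι → 𝕜}
    (h : ∀ i, Summable fun n => (w n * ‖x n i‖) ^ 2) :
    Summable fun n => (w n * ‖L (x n)‖) ^ 2 := by
  cases nonempty_fintype ι
  refine ((summable_sum (s := Finset.univ) fun i _ => h i).mul_left (‖L‖ ^ 2)).of_nonneg_of_le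
    (fun n => by positivity) fun n => ?_
  calc (w n * ‖L (x n)‖) ^ 2 = w n ^ 2 * ‖L (x n)‖ ^ 2 := mul_pow ..
    _ ≤ w n ^ 2 * (‖L‖ * ‖x n‖) ^ 2 := by gcongr; exact L.le_opNorm _
    _ = ‖L‖ ^ 2 * (w n ^ 2 * ‖x n‖ ^ 2) := by ring
    _ ≤ ‖L‖ ^ 2 * (w n ^ 2 * ∑ i, ‖x n i‖ ^ 2) := by gcongr; exact sq_norm_le_sum_sq_norm _
    _ = ‖L‖ ^ 2 * ∑ i, (w n * ‖x n i‖) ^ 2 := by simp only [mul_pow, Finset.mul_sum]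

variable [Fintype ι]

theorem summable_sq_norm_coeff (f : ι → H) : Summable fun n => ‖coeff b n f‖ ^ 2 := by
  have h := summable_sq_mul_norm_map (.id 𝕜 (ι → 𝕜)) (w := fun _ => 1)
    (x := fun n => coeff b n f) fun i => by
      simpa only [one_mul, coeff_apply] using (hasSum_sq_norm_repr b (f i)).summable
  simpa only [one_mul, ContinuousLinearMap.id_apply] using h

theorem exists_coeff_eq {x : J → ι → 𝕜} (hx : Summable fun n => ‖x n‖ ^ 2) :
    ∃ f : ι → H, ∀ n, coeff b n f = x n := by
  have h (i : ι) : ∃ f : H, ∀ n, b.repr f n = x n i :=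
    exists_repr_eq b <| hx.of_nonneg_of_le (fun n => by positivity) fun n => by
      gcongr
      exact norm_le_pi_norm (x n) i
  choose f hf using h
  exact ⟨f, fun n => funext fun i => by rw [coeff_apply, hf]⟩

theorem tendsto_of_coeff {α : Type*} {l : Filter α} {u : α → ι → H} {f : ι → H} {c : J → ℝ}
    (hc : Summable c) (h : ∀ n, Tendsto (fun a => coeff b n (u a)) l (𝓝 (coeff b n f)))
    (hbound : ∀ᶠ a in l, ∀ n, ‖coeff b n (u a) - coeff b n f‖ ^ 2 ≤ c n) :
    Tendsto u l (𝓝 f) := by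
  refine tendsto_pi_nhds.2 fun i => tendsto_of_repr b hc (fun n => ?_) ?_
  · simpa only [coeff_apply] using tendsto_pi_nhds.1 (h n) i
  · filter_upwards [hbound] with a ha n
    refine le_trans ?_ (ha n)
    gcongr
    simpa only [Pi.sub_apply, coeff_apply] using
      norm_le_pi_norm (coeff b n (u a) - coeff b n f) i

theorem exists_multiplier [Fintype κ] (m : J → (ι → 𝕜) →L[𝕜] (κ → 𝕜)) {C : ℝ}
    (hm : ∀ n, ‖m n‖ ≤ C) :
    ∃ T : (ι → H) →L[𝕜] (κ → H), ∀ n f, coeff b n (T f) = m n (coeff b n f) := by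
  have : CompleteSpace H :=
    (completeSpace_congr (e := b.repr.toEquiv) b.repr.isometry.isUniformEmbedding).2 inferInstance
  have hT (f : ι → H) : ∃ g : κ → H, ∀ n, coeff b n g = m n (coeff b n f) := by
    refine exists_coeff_eq b (((summable_sq_norm_coeff b f).mul_left (C ^ 2)).of_nonneg_of_le
      (fun n => by positivity) fun n => ?_)
    rw [← mul_pow]
    gcongr
    exact (m n).le_of_opNorm_le (hm n) _
  choose T hT using hT
  let L : (ι → H) →ₗ[𝕜] (κ → H) :=
    { toFun := T
      map_add' := fun f g => ext_coeff b fun n => by simp only [hT, map_add]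
      map_smul' := fun c f => ext_coeff b fun n => by simp only [hT, map_smul, RingHom.id_apply] }
  refine ⟨⟨L, L.continuous_of_seq_closed_graph fun u f g hu hLu => ext_coeff b fun n => ?_⟩,
    fun n f => hT f n⟩
  have hg := ((coeff b n).continuous.tendsto g).comp hLu
  have hf := ((m n).continuous.tendsto _).comp (((coeff b n).continuous.tendsto f).comp hu)
  exact (tendsto_nhds_unique hg (hf.congr fun k => (hT (u k) n).symm)).trans (hT f n).symm

end HilbertBasis

/-! ### Uniformly continuous semigroups and orbits of strongly continuous semigroups -/

section Flow

variable {X : Type*} [NormedAddCommGroup X] [NormedSpace ℂ X]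

/-- The semigroup `t ↦ exp (t G)` generated by a bounded operator `G`. -/
def flow (G : X →L[ℂ] X) (t : ℝ) : X →L[ℂ] X := NormedSpace.exp (t • G)

theorem flow_zero (G : X →L[ℂ] X) : flow G 0 = ContinuousLinearMap.id ℂ X := by
  rw [flow, zero_smul, NormedSpace.exp_zero]
  rfl

variable [CompleteSpace X]

theorem flow_add (G : X →L[ℂ] X) (s t : ℝ) : flow G (s + t) = (flow G s).comp (flow G t) := by
  let _ : NormedAlgebra ℚ (X →L[ℂ] X) := NormedAlgebra.restrictScalars ℚ ℝ _
  rw [flow, add_smul, NormedSpace.exp_add_of_commute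
    (((Commute.refl G).smul_left s).smul_right t)]
  rfl

theorem hasDerivAt_flow (G : X →L[ℂ] X) (x : X) (t : ℝ) :
    HasDerivAt (fun s => flow G s x) (G (flow G t x)) t :=
  ((ContinuousLinearMap.apply ℂ X x).restrictScalars ℝ).hasFDerivAt.comp_hasDerivAt t
    (hasDerivAt_exp_smul_const' (𝕂 := ℝ) G t)

theorem flow_apply_comm (G : X →L[ℂ] X) (x : X) (t : ℝ) : flow G t (G x) = G (flow G t x) :=
  (((ContinuousLinearMap.apply ℂ X x).restrictScalars ℝ).hasFDerivAt.comp_hasDerivAt t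
    (hasDerivAt_exp_smul_const (𝕂 := ℝ) G t)).unique (hasDerivAt_flow G x t)

theorem continuous_flow (G : X →L[ℂ] X) : Continuous (flow G) :=
  continuous_iff_continuousAt.2 fun t => (hasDerivAt_exp_smul_const (𝕂 := ℝ) G t).continuousAt

theorem exists_norm_flow_le (G : X →L[ℂ] X) (T : ℝ) :
    ∃ C, ∀ t ∈ Set.Icc 0 T, ‖flow G t‖ ≤ C :=
  isCompact_Icc.exists_bound_of_continuousOn (continuous_flow G).continuousOn

theorem norm_flow_sub_le (G : X →L[ℂ] X) (x : X) {C T : ℝ}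
    (hC : ∀ t ∈ Set.Icc 0 T, ‖flow G t‖ ≤ C) {t : ℝ} (ht : t ∈ Set.Icc 0 T) :
    ‖flow G t x - x‖ ≤ C * ‖G x‖ * t := by
  have h := norm_image_sub_le_of_norm_deriv_le_segment' (f := fun s => flow G s x)
    (fun s _ => (hasDerivAt_flow G x s).hasDerivWithinAt)
    (fun s hs => by
      rw [← flow_apply_comm]
      exact (flow G s).le_of_opNorm_le (hC s (Set.Ico_subset_Icc_self hs)) _) t ht
  simpa only [flow_zero, ContinuousLinearMap.id_apply, sub_zero] using h

theorem eqOn_flow_of_hasDerivWithinAt (G : X →L[ℂ] X) {u : ℝ → X} {T : ℝ}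
    (hu : ContinuousOn u (Set.Icc 0 T))
    (hu' : ∀ t ∈ Set.Ico 0 T, HasDerivWithinAt u (G (u t)) (Set.Ici t) t) :
    Set.EqOn u (fun t => flow G t (u 0)) (Set.Icc 0 T) :=
  ODE_solution_unique (fun _ => G.lipschitz) hu hu'
    ((continuous_flow G).clm_apply continuous_const).continuousOn
    (fun t _ => (hasDerivAt_flow G (u 0) t).hasDerivWithinAt)
    (by rw [flow_zero, ContinuousLinearMap.id_apply])

end Flow

section Orbits

variable {X : Type*} [NormedAddCommGroup X] [NormedSpace ℂ X]

theorem tendsto_toNNReal_sub_nhdsGT (t : ℝ) :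
    Tendsto (fun s : ℝ => (s - t).toNNReal) (𝓝[>] t) (𝓝[>] 0) := by
  refine tendsto_nhdsWithin_iff.2 ⟨tendsto_nhdsWithin_of_tendsto_nhds ?_, ?_⟩
  · have hcont : Continuous fun s : ℝ => (s - t).toNNReal := by fun_prop
    simpa using hcont.tendsto t
  · filter_upwards [self_mem_nhdsWithin] with s hs
    exact Real.toNNReal_pos.2 (sub_pos.2 hs)

theorem tendsto_coe_nhdsGT_zero : Tendsto (fun s : ℝ≥0 => (s : ℝ)) (𝓝[>] 0) (𝓝[>] 0) := by
  refine tendsto_nhdsWithin_iff.2 ⟨tendsto_nhdsWithin_of_tendsto_nhds ?_, ?_⟩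
  · simpa using NNReal.continuous_coe.tendsto 0
  · filter_upwards [self_mem_nhdsWithin] with s hs
    exact NNReal.coe_pos.2 hs

theorem mem_generatorGraph_flow [CompleteSpace X] (G : X →L[ℂ] X) (x : X) :
    (x, G x) ∈ generatorGraph fun t : ℝ≥0 => flow G t := by
  have h := (hasDerivAt_flow G x 0).hasDerivWithinAt (s := Set.Ioi 0)
  rw [hasDerivWithinAt_iff_tendsto_slope' (by simp), flow_zero] at h
  refine (h.comp tendsto_coe_nhdsGT_zero).congr fun t => ?_
  rw [Function.comp_apply, slope_def_module, flow_zero, sub_zero, ← Complex.ofReal_inv,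
    Complex.coe_smul, ContinuousLinearMap.id_apply]

variable {S : ℝ≥0 → X →L[ℂ] X}

theorem IsC0Semigroup.mem_generatorGraph_apply (hS : IsC0Semigroup S) {x y : X}
    (h : (x, y) ∈ generatorGraph S) (t : ℝ≥0) : (S t x, S t y) ∈ generatorGraph S := by
  refine (((S t).continuous.tendsto y).comp (show Tendsto _ _ _ from h)).congr fun s => ?_
  have hcomm : S s (S t x) = S t (S s x) := by
    rw [← ContinuousLinearMap.comp_apply, ← hS.map_add, add_comm, hS.map_add,
      ContinuousLinearMap.comp_apply]
  simp only [Function.comp_apply, map_smul, map_sub, hcomm]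

theorem IsC0Semigroup.hasDerivWithinAt_orbit (hS : IsC0Semigroup S) {x y : X}
    (h : (x, y) ∈ generatorGraph S) {s : ℝ} (hs : 0 ≤ s) :
    HasDerivWithinAt (fun r : ℝ => S r.toNNReal x) (S s.toNNReal y) (Set.Ici s) s := by
  rw [← hasDerivWithinAt_Ioi_iff_Ici, hasDerivWithinAt_iff_tendsto_slope' (by simp)]
  have hlim : Tendsto _ _ _ := hS.mem_generatorGraph_apply h s.toNNReal
  refine (hlim.comp (tendsto_toNNReal_sub_nhdsGT s)).congr' ?_
  filter_upwards [self_mem_nhdsWithin] with r (hsr : s < r)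
  have horbit : S (r - s).toNNReal (S s.toNNReal x) = S r.toNNReal x := by
    rw [← ContinuousLinearMap.comp_apply, ← hS.map_add, ← Real.toNNReal_add (by linarith) hs,
      sub_add_cancel]
  rw [Function.comp_apply, slope_def_module, horbit, Real.coe_toNNReal _ (by linarith),
    ← Complex.ofReal_inv, Complex.coe_smul]

end Orbits

/-! ### Semigroups of Fourier multipliers -/

section Multiplier

/-- The semigroups generated by the operators `G n` are bounded on bounded time intervals,
uniformly in `n`. -/
def UniformlyBoundedFlow {J X : Type*} [NormedAddCommGroup X] [NormedSpace ℂ X]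
    (G : J → X →L[ℂ] X) : Prop :=
  ∀ T : ℝ, ∃ C : ℝ, ∀ n, ∀ t ∈ Set.Icc 0 T, ‖flow (G n) t‖ ≤ C

theorem UniformlyBoundedFlow.of_eventually_cofinite {J X : Type*} [NormedAddCommGroup X]
    [NormedSpace ℂ X] [CompleteSpace X] {G : J → X →L[ℂ] X}
    (h : ∀ T : ℝ, ∃ C : ℝ, ∀ᶠ n in cofinite, ∀ t ∈ Set.Icc 0 T, ‖flow (G n) t‖ ≤ C) :
    UniformlyBoundedFlow G := fun T => by
  obtain ⟨C, hC⟩ := h T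
  choose Q hQ using fun n => exists_norm_flow_le (G n) T
  obtain ⟨C', hC'⟩ := ((eventually_cofinite.1 hC).image Q).bddAbove
  refine ⟨max C C', fun n t ht => ?_⟩
  by_cases hn : ∀ t ∈ Set.Icc 0 T, ‖flow (G n) t‖ ≤ C
  · exact (hn t ht).trans (le_max_left C C')
  · exact (hQ n t ht).trans ((hC' ⟨n, hn, rfl⟩).trans (le_max_right C C'))

variable {J H ι : Type*} [NormedAddCommGroup H] [InnerProductSpace ℂ H]
  {b : HilbertBasis J ℂ H} {G : J → (ι → ℂ) →L[ℂ] (ι → ℂ)}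
  {S : ℝ≥0 → (ι → H) →L[ℂ] (ι → H)}

/-- The graph, on its maximal domain, of the operator acting on the `n`-th coefficients as the
matrix `G n`. -/
def symbolGraph (b : HilbertBasis J ℂ H) (G : J → (ι → ℂ) →L[ℂ] (ι → ℂ)) :
    Set ((ι → H) × (ι → H)) :=
  {p | ∀ n, coeff b n p.2 = G n (coeff b n p.1)}

theorem isClosed_symbolGraph : IsClosed (symbolGraph b G) := by
  rw [symbolGraph, Set.ofPred_forall]
  exact isClosed_iInter fun n => isClosed_eq (by fun_prop) (by fun_prop)

theorem exists_truncation_mem_symbolGraph [Finite ι] (b : HilbertBasis J ℂ H)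
    (G : J → (ι → ℂ) →L[ℂ] (ι → ℂ)) (s : Finset J) (f : ι → H) :
    ∃ g, (truncation b s f, g) ∈ symbolGraph b G := by
  cases nonempty_fintype ι
  classical
  exact exists_coeff_eq b (x := fun n => G n (coeff b n (truncation b s f))) <|
    summable_of_ne_finset_zero (s := s) fun n hn => by
      rw [coeff_truncation, if_neg hn, map_zero, norm_zero, zero_pow two_ne_zero]

variable [Fintype ι]

theorem isC0Semigroup_of_coeff (hG : UniformlyBoundedFlow G)
    (hS : ∀ t n f, coeff b n (S t f) = flow (G n) t (coeff b n f)) : IsC0Semigroup S where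
  map_zero := by
    ext1 f
    exact ext_coeff b fun n => by
      rw [hS, NNReal.coe_zero, flow_zero, ContinuousLinearMap.id_apply,
        ContinuousLinearMap.id_apply]
  map_add s t := by
    ext1 f
    exact ext_coeff b fun n => by
      rw [ContinuousLinearMap.comp_apply, hS, hS, hS, NNReal.coe_add, flow_add,
        ContinuousLinearMap.comp_apply]
  continuous_orbit f := by
    refine continuous_iff_continuousAt.2 fun t₀ => ?_
    obtain ⟨C, hC⟩ := hG (t₀ + 1)
    have hbound (n : J) (t : ℝ≥0) (ht : (t : ℝ) ≤ t₀ + 1) :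
        ‖flow (G n) t (coeff b n f)‖ ≤ C * ‖coeff b n f‖ :=
      (flow (G n) t).le_of_opNorm_le (hC n t ⟨t.2, ht⟩) _
    refine tendsto_of_coeff b (c := fun n => (2 * C) ^ 2 * ‖coeff b n f‖ ^ 2)
      ((summable_sq_norm_coeff b f).mul_left _) (fun n => ?_) ?_
    · simp only [hS]
      exact (((continuous_flow (G n)).comp NNReal.continuous_coe).clm_apply
        continuous_const).tendsto t₀
    · filter_upwards [eventually_le_nhds (lt_add_one t₀)] with t ht n
      rw [hS, hS, ← mul_pow]
      gcongr
      linarith [norm_sub_le (flow (G n) t (coeff b n f)) (flow (G n) t₀ (coeff b n f)),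
        hbound n t (mod_cast ht), hbound n t₀ (by linarith)]

theorem generatorGraph_eq_symbolGraph (hG : UniformlyBoundedFlow G)
    (hS : ∀ t n f, coeff b n (S t f) = flow (G n) t (coeff b n f)) :
    generatorGraph S = symbolGraph b G := by
  have coeff_quotient (n : J) (f : ι → H) (t : ℝ≥0) :
      coeff b n (((t : ℝ) : ℂ)⁻¹ • (S t f - f))
        = ((t : ℝ) : ℂ)⁻¹ • (flow (G n) t (coeff b n f) - coeff b n f) := by
    rw [map_smul, map_sub, hS]
  have tendsto_quotient (n : J) (f : ι → H) :
      Tendsto (fun t : ℝ≥0 => ((t : ℝ) : ℂ)⁻¹ • (flow (G n) t (coeff b n f) - coeff b n f))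
        (𝓝[>] 0) (𝓝 (G n (coeff b n f))) := mem_generatorGraph_flow (G n) (coeff b n f)
  ext ⟨f, g⟩
  refine ⟨fun (h : Tendsto _ _ _) n => ?_, fun h => ?_⟩
  · exact tendsto_nhds_unique ((((coeff b n).continuous.tendsto g).comp h).congr
      (coeff_quotient n f)) (tendsto_quotient n f)
  obtain ⟨C, hC⟩ := hG 1
  refine tendsto_of_coeff b (c := fun n => (C + 1) ^ 2 * ‖coeff b n g‖ ^ 2)
    ((summable_sq_norm_coeff b g).mul_left _) (fun n => ?_) ?_
  · simp only [coeff_quotient]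
    rw [h n]
    exact tendsto_quotient n f
  · filter_upwards [self_mem_nhdsWithin,
      mem_nhdsWithin_of_mem_nhds (eventually_le_nhds (zero_lt_one (α := ℝ≥0)))] with t ht0 ht1 n
    have ht0 : 0 < (t : ℝ) := ht0
    have hquot : ‖((t : ℝ) : ℂ)⁻¹ • (flow (G n) t (coeff b n f) - coeff b n f)‖
        ≤ C * ‖coeff b n g‖ := by
      rw [norm_smul, norm_inv, Complex.norm_real, Real.norm_of_nonneg ht0.le,
        inv_mul_le_iff₀ ht0, mul_comm (t : ℝ), h n]
      exact norm_flow_sub_le (G n) (coeff b n f) (hC n) ⟨t.2, mod_cast ht1⟩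
    rw [coeff_quotient, ← mul_pow]
    gcongr
    linarith [norm_sub_le (((t : ℝ) : ℂ)⁻¹ • (flow (G n) t (coeff b n f) - coeff b n f))
      (coeff b n g)]

theorem exists_semigroup_of_symbol (b : HilbertBasis J ℂ H) (hG : UniformlyBoundedFlow G) :
    ∃ S : ℝ≥0 → (ι → H) →L[ℂ] (ι → H),
      ∀ t n f, coeff b n (S t f) = flow (G n) t (coeff b n f) := by
  have hex (t : ℝ≥0) : ∃ T : (ι → H) →L[ℂ] (ι → H),
      ∀ n f, coeff b n (T f) = flow (G n) t (coeff b n f) := by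
    obtain ⟨C, hC⟩ := hG t
    exact exists_multiplier b _ fun n => hC n t ⟨t.2, le_rfl⟩
  exact Classical.skolem.1 hex

theorem IsC0Semigroup.coeff_apply_of_mem (hS : IsC0Semigroup S)
    (hgen : generatorGraph S = symbolGraph b G) {f g : ι → H} (h : (f, g) ∈ generatorGraph S)
    (t : ℝ≥0) (n : J) : coeff b n (S t f) = flow (G n) t (coeff b n f) := by
  have hcont : Continuous fun s : ℝ => coeff b n (S s.toNNReal f) :=
    (coeff b n).continuous.comp ((hS.continuous_orbit f).comp continuous_real_toNNReal)
  have hderiv (s : ℝ) (hs : s ∈ Set.Ico 0 (t : ℝ)) :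
      HasDerivWithinAt (fun s : ℝ => coeff b n (S s.toNNReal f))
        (G n (coeff b n (S s.toNNReal f))) (Set.Ici s) s := by
    have hmem := hgen ▸ hS.mem_generatorGraph_apply h s.toNNReal
    rw [← hmem n]
    exact ((coeff b n).restrictScalars ℝ).hasFDerivAt.comp_hasDerivWithinAt s
      (hS.hasDerivWithinAt_orbit h hs.1)
  have := eqOn_flow_of_hasDerivWithinAt (G n) hcont.continuousOn hderiv
    (Set.right_mem_Icc.2 t.coe_nonneg)
  simpa only [Real.toNNReal_coe, Real.toNNReal_zero, hS.map_zero, ContinuousLinearMap.id_apply]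
    using this

-- Truncations lie in the domain of the generator and are dense.
theorem IsC0Semigroup.coeff_apply (hS : IsC0Semigroup S)
    (hgen : generatorGraph S = symbolGraph b G) (t : ℝ≥0) (n : J) (f : ι → H) :
    coeff b n (S t f) = flow (G n) t (coeff b n f) := by
  have hlhs := ((coeff b n).comp (S t)).continuous.continuousAt.tendsto.comp
    (tendsto_truncation b f)
  have hrhs := ((flow (G n) t).comp (coeff b n)).continuous.continuousAt.tendsto.comp
    (tendsto_truncation b f)
  refine tendsto_nhds_unique hlhs (hrhs.congr fun s => ?_)
  obtain ⟨g, hg⟩ := exists_truncation_mem_symbolGraph b G s f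
  exact (hS.coeff_apply_of_mem hgen (hgen ▸ hg) t n).symm

theorem existsUnique_isC0Semigroup_of_symbol (b : HilbertBasis J ℂ H)
    (hG : UniformlyBoundedFlow G) :
    ∃! S : ℝ≥0 → (ι → H) →L[ℂ] (ι → H),
      IsC0Semigroup S ∧ generatorGraph S = symbolGraph b G := by
  obtain ⟨S, hS⟩ := exists_semigroup_of_symbol b hG
  refine ⟨S, ⟨isC0Semigroup_of_coeff hG hS, generatorGraph_eq_symbolGraph hG hS⟩, ?_⟩
  rintro S' ⟨hS', hgen⟩
  funext t
  ext1 f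
  exact ext_coeff b fun n => by rw [hS'.coeff_apply hgen, hS]

end Multiplier

/-! ### Energy estimates for coupled curves -/

section Energy

variable {E F : Type*} [NormedAddCommGroup E] [NormedAddCommGroup F]

/-- A regularization of the norm which, for `ε ≠ 0`, is differentiable at the origin too. -/
def regNorm (ε : ℝ) (v : E) : ℝ := √(‖v‖ ^ 2 + ε ^ 2)

theorem sq_regNorm (ε : ℝ) (v : E) : regNorm ε v ^ 2 = ‖v‖ ^ 2 + ε ^ 2 :=
  Real.sq_sqrt (by positivity)

theorem regNorm_zero (v : E) : regNorm 0 v = ‖v‖ := by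
  rw [regNorm, zero_pow two_ne_zero, add_zero, Real.sqrt_sq (norm_nonneg v)]

theorem norm_le_regNorm (ε : ℝ) (v : E) : ‖v‖ ≤ regNorm ε v :=
  Real.le_sqrt_of_sq_le (le_add_of_nonneg_right (sq_nonneg ε))

theorem le_regNorm (ε : ℝ) (v : E) : ε ≤ regNorm ε v :=
  Real.le_sqrt_of_sq_le (le_add_of_nonneg_left (sq_nonneg ‖v‖))

theorem continuous_regNorm_left (v : E) : Continuous fun ε => regNorm ε v := by
  unfold regNorm
  fun_prop

variable [InnerProductSpace ℝ E] [InnerProductSpace ℝ F]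

theorem hasDerivAt_regNorm {ε : ℝ} (hε : 0 < ε) {u : ℝ → E} {u' : E} {t : ℝ}
    (hu : HasDerivAt u u' t) :
    HasDerivAt (fun s => regNorm ε (u s)) (inner ℝ (u t) u' / regNorm ε (u t)) t :=
  ((hu.norm_sq.add_const (ε ^ 2)).sqrt (by positivity)).congr_deriv
    (mul_div_mul_left _ _ two_ne_zero)

theorem inner_div_regNorm_le {ε a g : ℝ} (hε : 0 < ε) (hg : 0 ≤ g) {v w : E}
    (h : inner ℝ v w ≤ ‖v‖ * (a * ‖v‖ + g)) :
    inner ℝ v w / regNorm ε v ≤ a * regNorm ε v + |a| * ε + g := by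
  have hR : ε ≤ regNorm ε v := le_regNorm ε v
  have hv : ‖v‖ ≤ regNorm ε v := norm_le_regNorm ε v
  rw [div_le_iff₀ (hε.trans_le hR)]
  calc inner ℝ v w ≤ a * (regNorm ε v ^ 2 - ε ^ 2) + ‖v‖ * g := by
        rw [sq_regNorm]
        linarith
    _ ≤ a * regNorm ε v ^ 2 + |a| * ε * ε + ‖v‖ * g := by
        nlinarith [neg_abs_le a, sq_nonneg ε]
    _ ≤ a * regNorm ε v ^ 2 + |a| * ε * regNorm ε v + regNorm ε v * g := by gcongr
    _ = (a * regNorm ε v + |a| * ε + g) * regNorm ε v := by ring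

theorem regNorm_add_mul_regNorm_le_gronwallBound {h h' : ℝ → E} {p p' : ℝ → F}
    {a₁₁ a₁₂ a₂₁ a₂₂ g₁ g₂ w κ ε T : ℝ} (ha₁₂ : 0 ≤ a₁₂) (ha₂₁ : 0 ≤ a₂₁) (hg₁ : 0 ≤ g₁)
    (hg₂ : 0 ≤ g₂) (hw : 0 ≤ w) (hκ₁ : a₁₁ + w * a₂₁ ≤ κ) (hκ₂ : a₁₂ + w * a₂₂ ≤ κ * w)
    (hε : 0 < ε) (hh : ∀ t, HasDerivAt h (h' t) t) (hp : ∀ t, HasDerivAt p (p' t) t)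
    (hh' : ∀ t ∈ Set.Icc 0 T, inner ℝ (h t) (h' t) ≤ ‖h t‖ * (a₁₁ * ‖h t‖ + (a₁₂ * ‖p t‖ + g₁)))
    (hp' : ∀ t ∈ Set.Icc 0 T, inner ℝ (p t) (p' t) ≤ ‖p t‖ * (a₂₂ * ‖p t‖ + (a₂₁ * ‖h t‖ + g₂)))
    {t : ℝ} (ht : t ∈ Set.Icc 0 T) :
    regNorm ε (h t) + w * regNorm ε (p t) ≤
      gronwallBound (regNorm ε (h 0) + w * regNorm ε (p 0)) κ
        (g₁ + w * g₂ + (|a₁₁| + w * |a₂₂|) * ε) t := by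
  have hderiv (s : ℝ) : HasDerivAt (fun s => regNorm ε (h s) + w * regNorm ε (p s))
      (inner ℝ (h s) (h' s) / regNorm ε (h s) + w * (inner ℝ (p s) (p' s) / regNorm ε (p s))) s :=
    (hasDerivAt_regNorm hε (hh s)).add ((hasDerivAt_regNorm hε (hp s)).const_mul w)
  have hineq (s : ℝ) (hs : s ∈ Set.Ico 0 T) :
      inner ℝ (h s) (h' s) / regNorm ε (h s) + w * (inner ℝ (p s) (p' s) / regNorm ε (p s)) ≤
        κ * (regNorm ε (h s) + w * regNorm ε (p s))
          + (g₁ + w * g₂ + (|a₁₁| + w * |a₂₂|) * ε) := by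
    have hh_le := inner_div_regNorm_le hε (by positivity) (hh' s (Set.Ico_subset_Icc_self hs))
    have hp_le := inner_div_regNorm_le hε (by positivity) (hp' s (Set.Ico_subset_Icc_self hs))
    have hhR := norm_le_regNorm ε (h s)
    have hpR := norm_le_regNorm ε (p s)
    have hh0 := (norm_nonneg (h s)).trans hhR
    have hp0 := (norm_nonneg (p s)).trans hpR
    calc _ ≤ a₁₁ * regNorm ε (h s) + |a₁₁| * ε + (a₁₂ * ‖p s‖ + g₁)
            + w * (a₂₂ * regNorm ε (p s) + |a₂₂| * ε + (a₂₁ * ‖h s‖ + g₂)) := by gcongr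
      _ ≤ a₁₁ * regNorm ε (h s) + |a₁₁| * ε + (a₁₂ * regNorm ε (p s) + g₁)
            + w * (a₂₂ * regNorm ε (p s) + |a₂₂| * ε + (a₂₁ * regNorm ε (h s) + g₂)) := by
          gcongr
      _ = (a₁₁ + w * a₂₁) * regNorm ε (h s) + (a₁₂ + w * a₂₂) * regNorm ε (p s)
            + (g₁ + w * g₂ + (|a₁₁| + w * |a₂₂|) * ε) := by ring
      _ ≤ κ * regNorm ε (h s) + κ * w * regNorm ε (p s)
            + (g₁ + w * g₂ + (|a₁₁| + w * |a₂₂|) * ε) := by gcongr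
      _ = _ := by ring
  simpa only [sub_zero] using le_gronwallBound_of_liminf_deriv_right_le
    (fun s _ => (hderiv s).continuousAt.continuousWithinAt)
    (fun s _ r hr => (hderiv s).hasDerivWithinAt.liminf_right_slope_le hr) le_rfl hineq t ht

theorem norm_add_mul_norm_le_gronwallBound {h h' : ℝ → E} {p p' : ℝ → F}
    {a₁₁ a₁₂ a₂₁ a₂₂ g₁ g₂ w κ T : ℝ} (ha₁₂ : 0 ≤ a₁₂) (ha₂₁ : 0 ≤ a₂₁) (hg₁ : 0 ≤ g₁)
    (hg₂ : 0 ≤ g₂) (hw : 0 ≤ w) (hκ₁ : a₁₁ + w * a₂₁ ≤ κ) (hκ₂ : a₁₂ + w * a₂₂ ≤ κ * w)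
    (hh : ∀ t, HasDerivAt h (h' t) t) (hp : ∀ t, HasDerivAt p (p' t) t)
    (hh' : ∀ t ∈ Set.Icc 0 T, inner ℝ (h t) (h' t) ≤ ‖h t‖ * (a₁₁ * ‖h t‖ + (a₁₂ * ‖p t‖ + g₁)))
    (hp' : ∀ t ∈ Set.Icc 0 T, inner ℝ (p t) (p' t) ≤ ‖p t‖ * (a₂₂ * ‖p t‖ + (a₂₁ * ‖h t‖ + g₂)))
    {t : ℝ} (ht : t ∈ Set.Icc 0 T) :
    ‖h t‖ + w * ‖p t‖ ≤ gronwallBound (‖h 0‖ + w * ‖p 0‖) κ (g₁ + w * g₂) t := by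
  have hcont : Continuous fun ε => gronwallBound (regNorm ε (h 0) + w * regNorm ε (p 0)) κ
      (g₁ + w * g₂ + (|a₁₁| + w * |a₂₂|) * ε) t := by
    have hcont_h := continuous_regNorm_left (h 0)
    have hcont_p := continuous_regNorm_left (p 0)
    unfold gronwallBound
    split_ifs <;> fun_prop
  have hlim := (hcont.tendsto 0).mono_left (nhdsWithin_le_nhds (s := Set.Ioi 0))
  simp only [regNorm_zero, mul_zero, add_zero] at hlim
  refine ge_of_tendsto hlim ?_
  filter_upwards [self_mem_nhdsWithin] with ε hε
  calc ‖h t‖ + w * ‖p t‖ ≤ regNorm ε (h t) + w * regNorm ε (p t) := by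
        gcongr <;> exact norm_le_regNorm ..
    _ ≤ _ := regNorm_add_mul_regNorm_le_gronwallBound ha₁₂ ha₂₁ hg₁ hg₂ hw hκ₁ hκ₂ hε hh hp
        hh' hp' ht

theorem norm_le_gronwallBound_of_inner_le {p p' : ℝ → F} {a g T : ℝ} (hg : 0 ≤ g)
    (hp : ∀ t, HasDerivAt p (p' t) t)
    (hp' : ∀ t ∈ Set.Icc 0 T, inner ℝ (p t) (p' t) ≤ ‖p t‖ * (a * ‖p t‖ + g))
    {t : ℝ} (ht : t ∈ Set.Icc 0 T) : ‖p t‖ ≤ gronwallBound ‖p 0‖ a g t := by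
  simpa using norm_add_mul_norm_le_gronwallBound (h := fun _ => (0 : F)) (h' := 0) (a₁₁ := a)
    (a₁₂ := 0) (a₂₁ := 0) (a₂₂ := a) (g₁ := 0) (g₂ := g) (w := 1) (κ := a) le_rfl le_rfl
    le_rfl hg zero_le_one (by simp) (by simp) (fun t => hasDerivAt_const t 0) hp (by simp)
    (by simpa using hp') ht

theorem gronwallBound_neg_le {δ a g t : ℝ} (ha : 0 < a) (hg : 0 ≤ g) :
    gronwallBound δ (-a) g t ≤ Real.exp (-a * t) * δ + g / a := by
  rw [gronwallBound_of_K_ne_0 (neg_ne_zero.2 ha.ne')]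
  have hexp : 0 ≤ g / a * Real.exp (-a * t) := by positivity
  have hsplit : g / -a * (Real.exp (-a * t) - 1) = g / a - g / a * Real.exp (-a * t) := by
    rw [div_neg]
    ring
  linarith [hsplit]

theorem norm_le_exp_neg_mul_add {p p' : ℝ → F} {a g T : ℝ} (ha : 0 < a) (hg : 0 ≤ g)
    (hp : ∀ t, HasDerivAt p (p' t) t)
    (hp' : ∀ t ∈ Set.Icc 0 T, inner ℝ (p t) (p' t) ≤ ‖p t‖ * (-a * ‖p t‖ + g))
    {t : ℝ} (ht : t ∈ Set.Icc 0 T) : ‖p t‖ ≤ Real.exp (-a * t) * ‖p 0‖ + g / a :=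
  (norm_le_gronwallBound_of_inner_le hg hp hp' ht).trans (gronwallBound_neg_le ha hg)

/- The weight `C / c / ρ` of `‖p‖` makes the damping `c * r ^ 2` absorb the coupling
`C * r ^ 2 / ρ` of `h` to `p`. -/
theorem norm_transport_le {h h' : ℝ → E} {p p' : ℝ → F} {c C r ρ T : ℝ} (hC : 0 < C)
    (hc : 0 < c) (hr : 0 < r) (hρ : r ≤ ρ)
    (hh : ∀ t, HasDerivAt h (h' t) t) (hp : ∀ t, HasDerivAt p (p' t) t)
    (hh' : ∀ t ∈ Set.Icc 0 T,
      inner ℝ (h t) (h' t) ≤ ‖h t‖ * (C * ‖h t‖ + C * r ^ 2 / ρ * ‖p t‖))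
    (hp' : ∀ t ∈ Set.Icc 0 T,
      inner ℝ (p t) (p' t) ≤ ‖p t‖ * (-(c * r ^ 2) * ‖p t‖ + C * r * ‖h t‖))
    {t : ℝ} (ht : t ∈ Set.Icc 0 T) :
    ‖h t‖ ≤ (1 + C / c) * Real.exp ((C + C ^ 2 / c) * T) * (‖h 0‖ + ‖p 0‖ / ρ) := by
  have hρ0 : 0 < ρ := hr.trans_le hρ
  have hgrowth : C + C / c / ρ * (C * r) ≤ C + C ^ 2 / c := by
    have : C / c / ρ * (C * r) = C ^ 2 / c * (r / ρ) := by ring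
    rw [this]
    gcongr
    exact mul_le_of_le_one_right (by positivity) ((div_le_one hρ0).2 hρ)
  have hcancel : C * r ^ 2 / ρ + C / c / ρ * -(c * r ^ 2) ≤ (C + C ^ 2 / c) * (C / c / ρ) := by
    have : C * r ^ 2 / ρ + C / c / ρ * -(c * r ^ 2) = 0 := by
      field_simp
      ring
    rw [this]
    positivity
  have hgronwall := norm_add_mul_norm_le_gronwallBound (g₁ := 0) (g₂ := 0) (w := C / c / ρ)
    (by positivity) (by positivity) le_rfl le_rfl (by positivity) hgrowth hcancel hh hp
    (by simpa only [add_zero] using hh') (by simpa only [add_zero] using hp') ht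
  rw [mul_zero, add_zero, gronwallBound_ε0] at hgronwall
  calc ‖h t‖ ≤ ‖h t‖ + C / c / ρ * ‖p t‖ := le_add_of_nonneg_right (by positivity)
    _ ≤ (‖h 0‖ + C / c / ρ * ‖p 0‖) * Real.exp ((C + C ^ 2 / c) * t) := hgronwall
    _ ≤ ((1 + C / c) * (‖h 0‖ + ‖p 0‖ / ρ)) * Real.exp ((C + C ^ 2 / c) * T) := by
        gcongr
        · have hh0 : 0 ≤ C / c * ‖h 0‖ := by positivity
          have hp0 : 0 ≤ ‖p 0‖ / ρ := by positivity
          linear_combination hh0 + hp0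
        · exact ht.2
    _ = _ := by ring

theorem norm_add_norm_le_of_coupled {h h' : ℝ → E} {p p' : ℝ → F} {c C r ρ T : ℝ} (hC : 0 < C)
    (hc : 0 < c) (hr : 1 ≤ r) (hρ : r ≤ ρ)
    (hh : ∀ t, HasDerivAt h (h' t) t) (hp : ∀ t, HasDerivAt p (p' t) t)
    (hh' : ∀ t ∈ Set.Icc 0 T,
      inner ℝ (h t) (h' t) ≤ ‖h t‖ * (C * ‖h t‖ + C * r ^ 2 / ρ * ‖p t‖))
    (hp' : ∀ t ∈ Set.Icc 0 T,
      inner ℝ (p t) (p' t) ≤ ‖p t‖ * (-(c * r ^ 2) * ‖p t‖ + C * r * ‖h t‖))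
    {t : ℝ} (ht : t ∈ Set.Icc 0 T) :
    ‖h t‖ + ‖p t‖ ≤ (1 + C / c) * ((1 + C / c) * Real.exp ((C + C ^ 2 / c) * T) *
      (‖h 0‖ + ‖p 0‖ / ρ)) + Real.exp (-(c * r ^ 2) * t) * ‖p 0‖ := by
  have hr0 : 0 < r := zero_lt_one.trans_le hr
  have hρ0 : 0 < ρ := hr0.trans_le hρ
  set H := (1 + C / c) * Real.exp ((C + C ^ 2 / c) * T) * (‖h 0‖ + ‖p 0‖ / ρ)
  have hH0 : 0 ≤ H := by positivity
  have hH (s : ℝ) (hs : s ∈ Set.Icc 0 T) : ‖h s‖ ≤ H :=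
    norm_transport_le hC hc hr0 hρ hh hp hh' hp' hs
  have hforced (s : ℝ) (hs : s ∈ Set.Icc 0 T) :
      inner ℝ (p s) (p' s) ≤ ‖p s‖ * (-(c * r ^ 2) * ‖p s‖ + C * r * H) := by
    refine (hp' s hs).trans ?_
    gcongr
    exact hH s hs
  calc ‖h t‖ + ‖p t‖
      ≤ H + (Real.exp (-(c * r ^ 2) * t) * ‖p 0‖ + C * r * H / (c * r ^ 2)) :=
        add_le_add (hH t ht)
          (norm_le_exp_neg_mul_add (by positivity) (by positivity) hp hforced ht)
    _ = H + C / c * H / r + Real.exp (-(c * r ^ 2) * t) * ‖p 0‖ := by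
        field_simp
        ring
    _ ≤ H + C / c * H + Real.exp (-(c * r ^ 2) * t) * ‖p 0‖ := by
        gcongr
        exact div_le_self (by positivity) hr
    _ = _ := by ring

end Energy

/-! ### Adapted pairs of projections -/

section Adapted

variable {X : Type*} [NormedAddCommGroup X] [NormedSpace ℂ X]

/-- The Fourier symbol of `B ∂ₓ² - A ∂ₓ - K` at the frequency `n`. -/
def symbol (A B K : X →L[ℂ] X) (n : ℤ) : X →L[ℂ] X :=
  -((n : ℂ) ^ 2 • B + (Complex.I * n) • A + K)

theorem symbol_apply (A B K : X →L[ℂ] X) (n : ℤ) (x : X) :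
    symbol A B K n x = -((n : ℂ) ^ 2 • B x + (Complex.I * n) • A x + K x) := rfl

variable {E F : Type*} [NormedAddCommGroup E] [InnerProductSpace ℂ E] [NormedAddCommGroup F]
  [InnerProductSpace ℂ F]

/-- The maps `h` and `p` read off the transported and the damped part of a state, in inner products
for which `A` is symmetric on the transported part up to a coupling of size `β` to the damped part,
and `B` is `c`-accretive on the damped part. The two parts together control the state. -/
structure IsAdapted (A B : X →L[ℂ] X) (h : X →L[ℂ] E) (p : X →L[ℂ] F) (c : ℝ) (β M : ℝ≥0) :
    Prop where
  c_pos : 0 < c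
  h_B : ∀ x, h (B x) = 0
  p_B : ∀ x, c * ‖p x‖ ^ 2 ≤ (inner ℂ (p x) (p (B x))).re
  h_A : ∀ x, |(inner ℂ (h x) (h (A x))).im| ≤ β * (‖h x‖ * ‖p x‖)
  norm_le : ∀ x, ‖x‖ ≤ M * (‖h x‖ + ‖p x‖)

/-- The number `k` of derivatives gained over the damped part of the data, when the transported
part is coupled to the damped one with size `β`. -/
def IsSmoothingGain (β : ℝ≥0) (k : ℕ) : Prop := k = 1 ∨ k = 2 ∧ β = 0

theorem neg_re_inner_le (x y : E) : -(inner ℂ x y).re ≤ ‖x‖ * ‖y‖ :=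
  (neg_le_abs _).trans ((Complex.abs_re_le_norm _).trans (norm_inner_le_norm x y))

theorem eventually_le_abs_intCast (N : ℝ) : ∀ᶠ n : ℤ in cofinite, N ≤ |(n : ℝ)| :=
  ((tendsto_norm_cocompact_atTop (E := ℝ)).comp Int.tendsto_coe_cofinite).eventually_ge_atTop N

theorem pow_mul_exp_neg_le {a r : ℝ} (ha : 0 < a) (hr : 1 ≤ r) {k : ℕ} (hk : k ≤ 2) :
    r ^ k * Real.exp (-(a * r ^ 2)) ≤ 1 / a := by
  rw [le_div_iff₀ ha]
  calc r ^ k * Real.exp (-(a * r ^ 2)) * a ≤ r ^ 2 * Real.exp (-(a * r ^ 2)) * a := by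
        gcongr
    _ = a * r ^ 2 * Real.exp (-(a * r ^ 2)) := by ring
    _ ≤ Real.exp (-1) := Real.mul_exp_neg_le_exp_neg_one _
    _ ≤ 1 := Real.exp_le_one_iff.2 (by norm_num)

namespace IsAdapted

variable {A B : X →L[ℂ] X} {h : X →L[ℂ] E} {p : X →L[ℂ] F} {c : ℝ} {β M : ℝ≥0}

theorem norm_apply_le (H : IsAdapted A B h p c β M) {G : Type*} [NormedAddCommGroup G]
    [NormedSpace ℂ G] (L : X →L[ℂ] G) (x : X) : ‖L x‖ ≤ ‖L‖ * M * (‖h x‖ + ‖p x‖) := by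
  rw [mul_assoc]
  exact L.le_opNorm_of_le (H.norm_le x)

theorem re_inner_transported_le (H : IsAdapted A B h p c β M) (K : X →L[ℂ] X) (n : ℤ) (x : X) :
    (inner ℂ (h x) (h (symbol A B K n x))).re ≤
      ‖h x‖ * (‖h.comp K‖ * M * ‖h x‖ + (β * |(n : ℝ)| + ‖h.comp K‖ * M) * ‖p x‖) := by
  have hre : (inner ℂ (h x) (h (symbol A B K n x))).re =
      n * (inner ℂ (h x) (h (A x))).im + -(inner ℂ (h x) (h.comp K x)).re := by
    simp [symbol_apply, H.h_B, inner_smul_right, Complex.mul_re]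
    ring
  have hA : n * (inner ℂ (h x) (h (A x))).im ≤ |(n : ℝ)| * (β * (‖h x‖ * ‖p x‖)) := by
    refine (le_abs_self _).trans ?_
    rw [abs_mul]
    gcongr
    exact H.h_A x
  calc (inner ℂ (h x) (h (symbol A B K n x))).re
      ≤ |(n : ℝ)| * (β * (‖h x‖ * ‖p x‖)) + ‖h x‖ * (‖h.comp K‖ * M * (‖h x‖ + ‖p x‖)) := by
        rw [hre]
        refine add_le_add hA ((neg_re_inner_le _ _).trans ?_)
        gcongr
        exact H.norm_apply_le (h.comp K) x
    _ = _ := by ring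

theorem re_inner_damped_le (H : IsAdapted A B h p c β M) (K : X →L[ℂ] X) {n : ℤ}
    (hn : 1 ≤ |(n : ℝ)|) (x : X) :
    (inner ℂ (p x) (p (symbol A B K n x))).re ≤
      ‖p x‖ * (((‖p.comp A‖ + ‖p.comp K‖) * M * |(n : ℝ)| - c * |(n : ℝ)| ^ 2) * ‖p x‖
        + (‖p.comp A‖ + ‖p.comp K‖) * M * |(n : ℝ)| * ‖h x‖) := by
  have hre : (inner ℂ (p x) (p (symbol A B K n x))).re =
      -(|(n : ℝ)| ^ 2 * (inner ℂ (p x) (p (B x))).re)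
        + -(inner ℂ (p x) ((Complex.I * n) • p.comp A x + p.comp K x)).re := by
    have hcast : (n : ℂ) ^ 2 = ((|(n : ℝ)| ^ 2 : ℝ) : ℂ) := by
      rw [sq_abs]
      push_cast
      rfl
    simp only [symbol_apply, map_neg, map_add, map_smul, inner_neg_right, inner_add_right,
      inner_smul_right, Complex.neg_re, Complex.add_re, hcast, Complex.re_ofReal_mul,
      ContinuousLinearMap.comp_apply]
    ring
  have hlower : ‖(Complex.I * n) • p.comp A x + p.comp K x‖ ≤
      |(n : ℝ)| * (‖p.comp A‖ * M * (‖h x‖ + ‖p x‖))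
        + |(n : ℝ)| * (‖p.comp K‖ * M * (‖h x‖ + ‖p x‖)) := by
    refine (norm_add_le _ _).trans (add_le_add ?_ ?_)
    · rw [norm_smul, norm_mul, Complex.norm_I, one_mul, Complex.norm_intCast]
      gcongr
      exact H.norm_apply_le (p.comp A) x
    · exact (H.norm_apply_le (p.comp K) x).trans (le_mul_of_one_le_left (by positivity) hn)
  calc (inner ℂ (p x) (p (symbol A B K n x))).re
      ≤ -(|(n : ℝ)| ^ 2 * (c * ‖p x‖ ^ 2))
        + ‖p x‖ * (|(n : ℝ)| * (‖p.comp A‖ * M * (‖h x‖ + ‖p x‖))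
          + |(n : ℝ)| * (‖p.comp K‖ * M * (‖h x‖ + ‖p x‖))) := by
        rw [hre]
        refine add_le_add ?_ ((neg_re_inner_le _ _).trans (by gcongr))
        gcongr
        exact H.p_B x
    _ = _ := by ring

theorem exists_energy_le (H : IsAdapted A B h p c β M) (K : X →L[ℂ] X) {k : ℕ}
    (hk : IsSmoothingGain β k) :
    ∃ C : ℝ, 0 < C ∧ ∀ᶠ n : ℤ in cofinite, ∀ x,
      (inner ℂ (h x) (h (symbol A B K n x))).re ≤
        ‖h x‖ * (C * ‖h x‖ + C * |(n : ℝ)| ^ 2 / |(n : ℝ)| ^ k * ‖p x‖) ∧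
      (inner ℂ (p x) (p (symbol A B K n x))).re ≤
        ‖p x‖ * (-(c / 2 * |(n : ℝ)| ^ 2) * ‖p x‖ + C * |(n : ℝ)| * ‖h x‖) := by
  set a := ‖h.comp K‖ * M
  set b := (‖p.comp A‖ + ‖p.comp K‖) * M
  have ha : 0 ≤ a := by positivity
  have hb : 0 ≤ b := by positivity
  have hc := H.c_pos
  refine ⟨a + b + β + 1, by positivity, ?_⟩
  filter_upwards [eventually_le_abs_intCast 1, eventually_le_abs_intCast (2 * b / c)]
    with n hn1 hn2 x
  have hn0 : 0 < |(n : ℝ)| := zero_lt_one.trans_le hn1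
  have hcoupling : β * |(n : ℝ)| + a ≤ (a + b + β + 1) * |(n : ℝ)| ^ 2 / |(n : ℝ)| ^ k := by
    rcases hk with rfl | ⟨rfl, rfl⟩
    · rw [pow_one, pow_two, ← mul_assoc, mul_div_cancel_right₀ _ hn0.ne']
      nlinarith
    · rw [mul_div_cancel_right₀ _ (by positivity), NNReal.coe_zero]
      linarith
  have hdamping : b * |(n : ℝ)| - c * |(n : ℝ)| ^ 2 ≤ -(c / 2 * |(n : ℝ)| ^ 2) := by
    rw [div_le_iff₀ hc] at hn2
    nlinarith
  constructor
  · refine (H.re_inner_transported_le K n x).trans ?_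
    gcongr
    linarith [β.coe_nonneg]
  · refine (H.re_inner_damped_le K hn1 x).trans ?_
    gcongr
    linarith [β.coe_nonneg]

variable [CompleteSpace X]

theorem exists_norm_flow_symbol_le (H : IsAdapted A B h p c β M) (K : X →L[ℂ] X) {k : ℕ}
    (hk : IsSmoothingGain β k) (T : ℝ) :
    ∃ C : ℝ, 0 ≤ C ∧ ∀ᶠ n : ℤ in cofinite, ∀ t ∈ Set.Icc 0 T, ∀ x,
      ‖flow (symbol A B K n) t x‖ ≤ C * (‖h x‖ + ‖p x‖ / |(n : ℝ)| ^ k)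
        + M * (Real.exp (-(c / 2 * |(n : ℝ)| ^ 2) * t) * ‖p x‖) := by
  obtain ⟨C, hC, henergy⟩ := H.exists_energy_le K hk
  have hc := H.c_pos
  refine ⟨M * ((1 + C / (c / 2)) * ((1 + C / (c / 2)) * Real.exp ((C + C ^ 2 / (c / 2)) * T))),
    by positivity, ?_⟩
  filter_upwards [henergy, eventually_le_abs_intCast 1] with n hen hn t ht x
  let _ := InnerProductSpace.complexToReal (G := E)
  let _ := InnerProductSpace.complexToReal (G := F)
  have hk0 : k ≠ 0 := by
    rcases hk with rfl | ⟨rfl, -⟩ <;> norm_num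
  have hcoupled := norm_add_norm_le_of_coupled (h := fun s => h (flow (symbol A B K n) s x))
    (p := fun s => p (flow (symbol A B K n) s x)) hC (half_pos hc) hn (le_self_pow₀ hn hk0)
    (fun s => (h.restrictScalars ℝ).hasFDerivAt.comp_hasDerivAt s (hasDerivAt_flow _ x s))
    (fun s => (p.restrictScalars ℝ).hasFDerivAt.comp_hasDerivAt s (hasDerivAt_flow _ x s))
    (fun s _ => (hen _).1) (fun s _ => (hen _).2) ht
  simp only [flow_zero, ContinuousLinearMap.id_apply] at hcoupled
  calc ‖flow (symbol A B K n) t x‖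
      ≤ M * (‖h (flow (symbol A B K n) t x)‖ + ‖p (flow (symbol A B K n) t x)‖) := H.norm_le _
    _ ≤ _ := mul_le_mul_of_nonneg_left hcoupled M.coe_nonneg
    _ = _ := by ring

theorem uniformlyBoundedFlow (H : IsAdapted A B h p c β M) (K : X →L[ℂ] X) :
    UniformlyBoundedFlow (symbol A B K) := by
  refine .of_eventually_cofinite fun T => ?_
  obtain ⟨C, hC, hflow⟩ := H.exists_norm_flow_symbol_le K (Or.inl rfl) T
  refine ⟨C * (‖h‖ + ‖p‖) + M * ‖p‖, ?_⟩
  filter_upwards [hflow, eventually_le_abs_intCast 1] with n hn hn1 t ht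
  refine ContinuousLinearMap.opNorm_le_bound _ (by positivity) fun x => (hn t ht x).trans ?_
  have hdamping : Real.exp (-(c / 2 * |(n : ℝ)| ^ 2) * t) ≤ 1 := by
    rw [Real.exp_le_one_iff, neg_mul, neg_nonpos]
    have := H.c_pos
    have := ht.1
    positivity
  calc C * (‖h x‖ + ‖p x‖ / |(n : ℝ)| ^ 1)
        + M * (Real.exp (-(c / 2 * |(n : ℝ)| ^ 2) * t) * ‖p x‖)
      ≤ C * (‖h x‖ + ‖p x‖) + M * (1 * ‖p x‖) := by
        gcongr
        exact div_le_self (norm_nonneg _) (one_le_pow₀ hn1)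
    _ ≤ C * (‖h‖ * ‖x‖ + ‖p‖ * ‖x‖) + M * (1 * (‖p‖ * ‖x‖)) := by
        gcongr <;> exact ContinuousLinearMap.le_opNorm _ _
    _ = _ := by ring

theorem exists_pow_mul_norm_flow_symbol_le (H : IsAdapted A B h p c β M) (K : X →L[ℂ] X) {k : ℕ}
    (hk : IsSmoothingGain β k) {t : ℝ} (ht : 0 < t) :
    ∃ C : ℝ, ∀ᶠ n : ℤ in cofinite, ∀ x,
      |(n : ℝ)| ^ k * ‖flow (symbol A B K n) t x‖ ≤ C * (|(n : ℝ)| ^ k * ‖h x‖ + ‖p x‖) := by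
  obtain ⟨C, hC, hflow⟩ := H.exists_norm_flow_symbol_le K hk t
  have hct : 0 < c / 2 * t := mul_pos (half_pos H.c_pos) ht
  have hk2 : k ≤ 2 := by
    rcases hk with rfl | ⟨rfl, -⟩ <;> norm_num
  refine ⟨C + M * (1 / (c / 2 * t)), ?_⟩
  filter_upwards [hflow, eventually_le_abs_intCast 1] with n hn hn1 x
  set r := |(n : ℝ)|
  have hr0 : 0 < r := zero_lt_one.trans_le hn1
  have hexp : r ^ k * Real.exp (-(c / 2 * r ^ 2) * t) ≤ 1 / (c / 2 * t) := by
    convert pow_mul_exp_neg_le hct hn1 hk2 using 3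
    ring
  calc r ^ k * ‖flow (symbol A B K n) t x‖
      ≤ r ^ k * (C * (‖h x‖ + ‖p x‖ / r ^ k)
          + M * (Real.exp (-(c / 2 * r ^ 2) * t) * ‖p x‖)) := by
        gcongr
        exact hn t (Set.right_mem_Icc.2 ht.le) x
    _ = C * (r ^ k * ‖h x‖ + ‖p x‖)
          + M * (r ^ k * Real.exp (-(c / 2 * r ^ 2) * t)) * ‖p x‖ := by
        field_simp
    _ ≤ C * (r ^ k * ‖h x‖ + ‖p x‖)
          + M * (1 / (c / 2 * t)) * (r ^ k * ‖h x‖ + ‖p x‖) := by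
        gcongr
        exact le_add_of_nonneg_left (by positivity)
    _ = _ := by ring

end IsAdapted

end Adapted

/-! ### Adapted inner products -/

theorem inner_mul_self (μ z : ℂ) : inner ℂ z (μ * z) = μ * ((‖z‖ ^ 2 : ℝ) : ℂ) := by
  rw [RCLike.inner_apply, mul_assoc, Complex.mul_conj, Complex.normSq_eq_norm_sq]

section Accretive

open Module

theorem exists_dual_eigenvector {K V : Type*} [Field K] [IsAlgClosed K] [AddCommGroup V]
    [Module K V] [FiniteDimensional K V] [Nontrivial V] (D : End K V) :
    ∃ (μ : K) (f : Dual K V), f ≠ 0 ∧ D.HasEigenvalue μ ∧ ∀ x, f (D x) = μ * f x := by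
  obtain ⟨μ, hμ⟩ := End.exists_eigenvalue (D.dualMap : End K (Dual K V))
  obtain ⟨f, hf⟩ := hμ.exists_hasEigenvector
  have hfD (x : V) : f (D x) = μ * f x := by
    simpa using LinearMap.congr_fun hf.apply_eq_smul x
  refine ⟨μ, f, hf.2, ?_, hfD⟩
  rw [End.hasEigenvalue_iff_mem_spectrum, spectrum.mem_iff, End.isUnit_iff]
  intro hbij
  obtain ⟨v, hv⟩ := LinearMap.surjective hf.2 1
  obtain ⟨y, hy⟩ := hbij.2 v
  have hfy := congr_arg f hy
  rw [LinearMap.sub_apply, algebraMap_end_apply, map_sub, map_smul, hfD, hv, smul_eq_mul,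
    sub_self] at hfy
  exact zero_ne_one hfy

variable {V : Type*} [AddCommGroup V] [Module ℂ V] {m : ℕ}

theorem exists_inner_cons (f : Dual ℂ V) (e : V →ₗ[ℂ] EuclideanSpace ℂ (Fin m)) :
    ∃ e' : V →ₗ[ℂ] EuclideanSpace ℂ (Fin (m + 1)), ∀ x y,
      inner ℂ (e' x) (e' y) = inner ℂ (f x) (f y) + inner ℂ (e x) (e y) := by
  refine ⟨(WithLp.linearEquiv 2 ℂ (Fin (m + 1) → ℂ)).symm.toLinearMap ∘ₗ
    LinearMap.pi (Fin.cons f fun i => (EuclideanSpace.proj i).toLinearMap ∘ₗ e), fun x y => ?_⟩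
  simp [PiLp.inner_apply, Fin.sum_univ_succ]

theorem exists_pos_le_quadratic {c s : ℝ} (hc : 0 < c) (hs : 0 < s) (b : ℝ) :
    ∃ R > 0, ∃ c' > 0, ∀ α φ : ℝ,
      c' * ((R * φ) ^ 2 + α ^ 2) ≤ s * (R * φ) ^ 2 + c * α ^ 2 - b * (α * φ) := by
  have hR : 0 < b ^ 2 / (c * s) + 1 := by positivity
  refine ⟨√(b ^ 2 / (c * s) + 1), Real.sqrt_pos.2 hR, min (c / 2) (s / 2), by positivity,
    fun α φ => ?_⟩
  have hmin_c : min (c / 2) (s / 2) * α ^ 2 ≤ c / 2 * α ^ 2 := by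
    gcongr
    exact min_le_left _ _
  have hmin_s : min (c / 2) (s / 2) * (b ^ 2 / (c * s) + 1) * φ ^ 2 ≤
      s / 2 * (b ^ 2 / (c * s) + 1) * φ ^ 2 := by
    gcongr
    exact min_le_right _ _
  have hsquare : 0 ≤ (c * α - b * φ) ^ 2 / (2 * c) + s / 2 * φ ^ 2 := by positivity
  have hcomplete : s / 2 * (b ^ 2 / (c * s) + 1) * φ ^ 2 + c / 2 * α ^ 2 - b * (α * φ) =
      (c * α - b * φ) ^ 2 / (2 * c) + s / 2 * φ ^ 2 := by
    field_simp
    ring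
  rw [mul_pow, Real.sq_sqrt hR.le]
  linarith

theorem exists_accretive_extension {D : End ℂ V} {f : Dual ℂ V} {μ : ℂ} (hμ : 0 < μ.re)
    (hfD : ∀ x, f (D x) = μ * f x) {e : V →ₗ[ℂ] EuclideanSpace ℂ (Fin m)}
    (he : ∀ x, f x = 0 → e x = 0 → x = 0) {w : EuclideanSpace ℂ (Fin m)} {c : ℝ} (hc : 0 < c)
    (hec : ∀ x, c * ‖e x‖ ^ 2 ≤ (inner ℂ (e x) (e (D x) - f x • w)).re) :
    ∃ (e' : V →ₗ[ℂ] EuclideanSpace ℂ (Fin (m + 1))) (c' : ℝ), Function.Injective e' ∧ 0 < c' ∧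
      ∀ x, c' * ‖e' x‖ ^ 2 ≤ (inner ℂ (e' x) (e' (D x))).re := by
  obtain ⟨R, hR, c', hc', hquad⟩ := exists_pos_le_quadratic hc hμ ‖w‖
  obtain ⟨e', he'⟩ := exists_inner_cons ((R : ℂ) • f) e
  have hnorm (x : V) : ‖e' x‖ ^ 2 = (R * ‖f x‖) ^ 2 + ‖e x‖ ^ 2 := by
    have hself := congr_arg Complex.re (he' x x)
    simp only [inner_self_eq_norm_sq_to_K, Complex.coe_algebraMap] at hself
    norm_cast at hself
    simpa [abs_of_pos hR] using hself
  refine ⟨e', c', (injective_iff_map_eq_zero _).2 fun x hx => ?_, hc', fun x => ?_⟩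
  · have hzero := hnorm x
    rw [hx, norm_zero, zero_pow two_ne_zero, eq_comm,
      add_eq_zero_iff_of_nonneg (sq_nonneg _) (sq_nonneg _)] at hzero
    exact he x (by simpa [hR.ne'] using hzero.1) (by simpa using hzero.2)
  · have hf : (inner ℂ (((R : ℂ) • f) x) (((R : ℂ) • f) (D x))).re = μ.re * (R * ‖f x‖) ^ 2 := by
      have hsmul : ((R : ℂ) • f) (D x) = μ * ((R : ℂ) • f) x := by
        simp only [LinearMap.smul_apply, hfD, smul_eq_mul]
        ring
      rw [hsmul, inner_mul_self, Complex.re_mul_ofReal, LinearMap.smul_apply, norm_smul,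
        Complex.norm_real, Real.norm_of_nonneg hR.le]
    have hcross : -(‖w‖ * (‖e x‖ * ‖f x‖)) ≤ (inner ℂ (e x) (f x • w)).re := by
      rw [neg_le]
      refine (neg_re_inner_le _ _).trans_eq ?_
      rw [norm_smul]
      ring
    have hsub := hec x
    rw [inner_sub_right, Complex.sub_re] at hsub
    rw [he', Complex.add_re, hf, hnorm]
    linarith [hquad ‖e x‖ ‖f x‖]

theorem exists_accretive_embedding [FiniteDimensional ℂ V] (hm : finrank ℂ V = m) (D : End ℂ V)
    (hD : ∀ μ, D.HasEigenvalue μ → 0 < μ.re) :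
    ∃ (e : V →ₗ[ℂ] EuclideanSpace ℂ (Fin m)) (c : ℝ), Function.Injective e ∧ 0 < c ∧
      ∀ x, c * ‖e x‖ ^ 2 ≤ (inner ℂ (e x) (e (D x))).re := by
  induction m generalizing V with
  | zero =>
    have := finrank_zero_iff.1 hm
    exact ⟨0, 1, Function.injective_of_subsingleton _, one_pos, by simp⟩
  | succ m ih =>
    have : Nontrivial V := nontrivial_of_finrank_pos (R := ℂ) (by omega)
    obtain ⟨μ, f, hf0, hμ, hfD⟩ := exists_dual_eigenvector D
    obtain ⟨v, hv⟩ := LinearMap.surjective hf0 1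
    have hmaps : ∀ x ∈ LinearMap.ker f, D x ∈ LinearMap.ker f := fun x hx => by
      rw [LinearMap.mem_ker] at hx ⊢
      rw [hfD, hx, mul_zero]
    have hrank : finrank ℂ (LinearMap.ker f) = m := by
      have := Dual.finrank_ker_add_one_of_ne_zero hf0
      omega
    obtain ⟨e, c, he, hc, hec⟩ := ih hrank (D.restrict hmaps) fun ν hν => by
      obtain ⟨x, hx⟩ := hν.exists_hasEigenvector
      refine hD ν (End.hasEigenvalue_of_hasEigenvector (x := (x : V)) ⟨?_, by simpa using hx.2⟩)
      rw [End.mem_eigenspace_iff]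
      exact congr_arg Subtype.val hx.apply_eq_smul
    let π : V →ₗ[ℂ] LinearMap.ker f :=
      (LinearMap.id - f.smulRight v).codRestrict _ fun x => by simp [hv]
    have hπ (x : V) : (π x : V) = x - f x • v := rfl
    have hπD (x : V) : D.restrict hmaps (π x) = π (D x) - f x • π (D v) := by
      ext
      simp only [LinearMap.coe_restrict_apply, hπ, AddSubgroupClass.coe_sub, SetLike.val_smul,
        map_sub, map_smul, hfD, hv]
      module
    refine exists_accretive_extension (e := e ∘ₗ π) (w := e (π (D v))) (hD μ hμ) hfD
      (fun x hfx hex => ?_) hc fun x => ?_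
    · have hπx := hπ x
      rw [(map_eq_zero_iff e he).1 hex, hfx] at hπx
      simpa using hπx.symm
    · simpa only [LinearMap.comp_apply, hπD, map_sub, map_smul] using hec (π x)

end Accretive

section Blocks

open scoped Matrix

theorem spectrum_conj_diagonal {ι K : Type*} [Fintype ι] [DecidableEq ι] [Field K]
    {P : Matrix ι ι K} (hP : IsUnit P.det) (v : ι → K) :
    spectrum K (P * Matrix.diagonal v * P⁻¹) = Set.range v := by
  have hconj : P * Matrix.diagonal v * P⁻¹ =
      (Matrix.nonsingInvUnit P hP : Matrix ι ι K) * Matrix.diagonal v *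
        ((Matrix.nonsingInvUnit P hP)⁻¹ : (Matrix ι ι K)ˣ) := by
    rw [Matrix.coe_units_inv]
    rfl
  rw [hconj, spectrum.units_conjugate, spectrum_diagonal]

theorem im_inner_diagonal_eq_zero {ι : Type*} [Fintype ι] [DecidableEq ι] {v : ι → ℂ}
    (hv : ∀ i, (v i).im = 0) (y : ι → ℂ) :
    (inner ℂ (WithLp.toLp 2 y : EuclideanSpace ℂ ι)
      (WithLp.toLp 2 (Matrix.diagonal v *ᵥ y))).im = 0 := by
  rw [PiLp.inner_apply, Complex.im_sum]
  refine Finset.sum_eq_zero fun i _ => ?_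
  rw [PiLp.toLp_apply, PiLp.toLp_apply, Matrix.mulVec_diagonal, inner_mul_self,
    Complex.im_mul_ofReal, hv, zero_mul]

theorem exists_symmetric_embedding {m : ℕ} {M : Matrix (Fin m) (Fin m) ℂ}
    (hM : IsDiagonalizable M) (hM_real : ∀ μ ∈ spectrum ℂ M, μ.im = 0) :
    ∃ e : (Fin m → ℂ) →ₗ[ℂ] EuclideanSpace ℂ (Fin m), Function.Injective e ∧
      ∀ y, (inner ℂ (e y) (e (M *ᵥ y))).im = 0 := by
  obtain ⟨P, hP, v, rfl⟩ := hM
  rw [spectrum_conj_diagonal hP, Set.forall_mem_range] at hM_real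
  refine ⟨(WithLp.linearEquiv 2 ℂ (Fin m → ℂ)).symm.toLinearMap ∘ₗ P⁻¹.mulVecLin, ?_, fun y => ?_⟩
  · rw [LinearMap.coe_comp]
    exact (LinearEquiv.injective _).comp
      (Matrix.mulVec_injective_of_isUnit ((Matrix.isUnit_nonsing_inv_iff).2
        ((Matrix.isUnit_iff_isUnit_det P).2 hP)))
  · have hconj : P⁻¹ *ᵥ ((P * Matrix.diagonal v * P⁻¹) *ᵥ y) =
        Matrix.diagonal v *ᵥ (P⁻¹ *ᵥ y) := by
      rw [Matrix.mulVec_mulVec, Matrix.mulVec_mulVec, Matrix.mul_assoc P,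
        Matrix.nonsing_inv_mul_cancel_left _ _ hP]
    simpa [hconj] using im_inner_diagonal_eq_zero hM_real (P⁻¹ *ᵥ y)

/-- The action of a real matrix on complex vectors. -/
def complexAction {ι κ : Type*} [Fintype ι] [Fintype κ] (M : Matrix ι κ ℝ) :
    (κ → ℂ) →L[ℂ] (ι → ℂ) :=
  LinearMap.toContinuousLinearMap (M.map (algebraMap ℝ ℂ)).mulVecLin

theorem complexAction_apply {ι κ : Type*} [Fintype ι] [Fintype κ] (M : Matrix ι κ ℝ)
    (x : κ → ℂ) : complexAction M x = M.map (algebraMap ℝ ℂ) *ᵥ x := rfl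

theorem complexAction_zero {ι κ : Type*} [Fintype ι] [Fintype κ] :
    complexAction (0 : Matrix ι κ ℝ) = 0 := by
  ext1 x
  simp [complexAction_apply]

variable {ι κ : Type*} [Fintype ι] [Fintype κ]

theorem complexAction_comp_inl (A : Matrix (ι ⊕ κ) (ι ⊕ κ) ℝ) (x : ι ⊕ κ → ℂ) :
    complexAction A x ∘ Sum.inl =
      complexAction A.toBlocks₁₁ (x ∘ Sum.inl) + complexAction A.toBlocks₁₂ (x ∘ Sum.inr) := by
  rw [complexAction_apply]
  conv_lhs => rw [← Matrix.fromBlocks_toBlocks A, Matrix.fromBlocks_map, Matrix.fromBlocks_mulVec]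
  rfl

theorem complexAction_comp_inr (A : Matrix (ι ⊕ κ) (ι ⊕ κ) ℝ) (x : ι ⊕ κ → ℂ) :
    complexAction A x ∘ Sum.inr =
      complexAction A.toBlocks₂₁ (x ∘ Sum.inl) + complexAction A.toBlocks₂₂ (x ∘ Sum.inr) := by
  rw [complexAction_apply]
  conv_lhs => rw [← Matrix.fromBlocks_toBlocks A, Matrix.fromBlocks_map, Matrix.fromBlocks_mulVec]
  rfl

theorem norm_le_norm_comp_inl_add_norm_comp_inr {E : Type*} [SeminormedAddCommGroup E]
    (x : ι ⊕ κ → E) : ‖x‖ ≤ ‖x ∘ Sum.inl‖ + ‖x ∘ Sum.inr‖ := by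
  refine (pi_norm_le_iff_of_nonneg (by positivity)).2 (Sum.forall.2 ⟨fun i => ?_, fun j => ?_⟩)
  · exact (norm_le_pi_norm (x ∘ Sum.inl) i).trans (le_add_of_nonneg_right (norm_nonneg _))
  · exact (norm_le_pi_norm (x ∘ Sum.inr) j).trans (le_add_of_nonneg_left (norm_nonneg _))

theorem isAdapted_complexAction (A : Matrix (ι ⊕ κ) (ι ⊕ κ) ℝ) (D : Matrix κ κ ℝ) {E F : Type*}
    [NormedAddCommGroup E] [InnerProductSpace ℂ E] [NormedAddCommGroup F] [InnerProductSpace ℂ F]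
    {eh : (ι → ℂ) →L[ℂ] E} {ep : (κ → ℂ) →L[ℂ] F} {c : ℝ} {Ch Cp : ℝ≥0} (hc : 0 < c)
    (heh : AntilipschitzWith Ch eh) (hep : AntilipschitzWith Cp ep)
    (h_symm : ∀ y, (inner ℂ (eh y) (eh (complexAction A.toBlocks₁₁ y))).im = 0)
    (h_accr : ∀ y, c * ‖ep y‖ ^ 2 ≤ (inner ℂ (ep y) (ep (complexAction D y))).re) :
    IsAdapted (complexAction A) (complexAction (Matrix.fromBlocks 0 0 0 D))
      (eh.comp (Pi.compRightL ℂ _ Sum.inl)) (ep.comp (Pi.compRightL ℂ _ Sum.inr)) c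
      (‖eh.comp (complexAction A.toBlocks₁₂)‖₊ * Cp) (Ch + Cp) where
  c_pos := hc
  h_B x := by
    change eh (complexAction _ x ∘ Sum.inl) = 0
    simp [complexAction_comp_inl, complexAction_zero]
  p_B x := by
    change c * ‖ep (x ∘ Sum.inr)‖ ^ 2 ≤
      (inner ℂ (ep (x ∘ Sum.inr)) (ep (complexAction _ x ∘ Sum.inr))).re
    simpa [complexAction_comp_inr, complexAction_zero] using h_accr (x ∘ Sum.inr)
  h_A x := by
    change |(inner ℂ (eh (x ∘ Sum.inl)) (eh (complexAction A x ∘ Sum.inl))).im| ≤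
      ‖eh.comp (complexAction A.toBlocks₁₂)‖ * Cp * (‖eh (x ∘ Sum.inl)‖ * ‖ep (x ∘ Sum.inr)‖)
    rw [complexAction_comp_inl, map_add, inner_add_right, Complex.add_im, h_symm, zero_add]
    refine (Complex.abs_im_le_norm _).trans ((norm_inner_le_norm _ _).trans ?_)
    calc _ ≤ ‖eh (x ∘ Sum.inl)‖ *
          (‖eh.comp (complexAction A.toBlocks₁₂)‖ * (Cp * ‖ep (x ∘ Sum.inr)‖)) := by
          gcongr
          exact (eh.comp (complexAction A.toBlocks₁₂)).le_opNorm_of_le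
            (hep.le_mul_norm (map_zero ep) _)
      _ = _ := by ring
  norm_le x := by
    change ‖x‖ ≤ (Ch + Cp) * (‖eh (x ∘ Sum.inl)‖ + ‖ep (x ∘ Sum.inr)‖)
    calc ‖x‖ ≤ ‖x ∘ Sum.inl‖ + ‖x ∘ Sum.inr‖ := norm_le_norm_comp_inl_add_norm_comp_inr x
      _ ≤ Ch * ‖eh (x ∘ Sum.inl)‖ + Cp * ‖ep (x ∘ Sum.inr)‖ :=
        add_le_add (heh.le_mul_norm (map_zero eh) _) (hep.le_mul_norm (map_zero ep) _)
      _ ≤ (Ch + Cp) * ‖eh (x ∘ Sum.inl)‖ + (Ch + Cp) * ‖ep (x ∘ Sum.inr)‖ := by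
        gcongr
        · exact le_add_of_nonneg_right Cp.coe_nonneg
        · exact le_add_of_nonneg_left Ch.coe_nonneg
      _ = _ := by ring

theorem exists_isAdapted {dh dp : ℕ} (A : Matrix (Fin dh ⊕ Fin dp) (Fin dh ⊕ Fin dp) ℝ)
    (D : Matrix (Fin dp) (Fin dp) ℝ) (hD : ∀ μ ∈ spectrum ℂ (toComplex D), 0 < μ.re)
    (hA : IsDiagonalizable (toComplex A.toBlocks₁₁))
    (hA_real : ∀ μ ∈ spectrum ℂ (toComplex A.toBlocks₁₁), μ.im = 0) :
    ∃ (eh : (Fin dh → ℂ) →L[ℂ] EuclideanSpace ℂ (Fin dh))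
      (ep : (Fin dp → ℂ) →L[ℂ] EuclideanSpace ℂ (Fin dp)) (c : ℝ) (β M : ℝ≥0),
      IsAdapted (complexAction A) (complexAction (Matrix.fromBlocks 0 0 0 D))
        (eh.comp (Pi.compRightL ℂ _ Sum.inl)) (ep.comp (Pi.compRightL ℂ _ Sum.inr)) c β M ∧
      (A.toBlocks₁₂ = 0 → β = 0) := by
  obtain ⟨eh, heh, h_symm⟩ := exists_symmetric_embedding hA hA_real
  obtain ⟨ep, c, hep, hc, h_accr⟩ := exists_accretive_embedding (V := Fin dp → ℂ) (m := dp)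
    (by simp) (Matrix.toLin' (toComplex D)) fun μ hμ => hD μ <| by
      rwa [Module.End.hasEigenvalue_iff_mem_spectrum, Matrix.spectrum_toLin'] at hμ
  obtain ⟨Ch, -, hCh⟩ := eh.exists_antilipschitzWith (LinearMap.ker_eq_bot.2 heh)
  obtain ⟨Cp, -, hCp⟩ := ep.exists_antilipschitzWith (LinearMap.ker_eq_bot.2 hep)
  refine ⟨eh.toContinuousLinearMap, ep.toContinuousLinearMap, c, _, _,
    isAdapted_complexAction A D hc hCh hCp h_symm h_accr, fun hA₁₂ => ?_⟩
  rw [hA₁₂, complexAction_zero, ContinuousLinearMap.comp_zero, nnnorm_zero, zero_mul]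

end Blocks

/-! ### Weak derivatives on the torus and Fourier coefficients -/

section Circle

variable {T : ℝ}

theorem continuous_of_continuous_coe {α : Type*} [TopologicalSpace α] {φ : AddCircle T → α}
    (h : Continuous fun x : ℝ => φ x) : Continuous φ :=
  (QuotientAddGroup.isQuotientMap_mk (N := AddSubgroup.zmultiples T)).continuous_iff.2 h

variable [hT : Fact (0 < T)]

theorem integral_deriv_eq_zero {E : Type*} [NormedAddCommGroup E] [NormedSpace ℝ E]
    [CompleteSpace E] {χ χ' : AddCircle T → E} (hχ' : Continuous χ')
    (h : ∀ x : ℝ, HasDerivAt (fun y : ℝ => χ y) (χ' x) x) :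
    ∫ x, χ' x ∂AddCircle.haarAddCircle = 0 := by
  have hperiod : χ ((0 + T : ℝ) : AddCircle T) = χ ((0 : ℝ) : AddCircle T) := by
    rw [zero_add, AddCircle.coe_period, AddCircle.coe_zero]
  rw [AddCircle.integral_haarAddCircle, ← AddCircle.intervalIntegral_preimage T 0,
    intervalIntegral.integral_eq_sub_of_hasDerivAt (fun x _ => h x)
      ((hχ'.comp (AddCircle.continuous_mk' T)).intervalIntegrable _ _),
    hperiod, sub_self, smul_zero]

theorem hasSum_integral_fourier_mul_fourierCoeff {u : AddCircle T → ℂ} (hu : Continuous u)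
    (q : Lp ℂ 2 (AddCircle.haarAddCircle (T := T))) :
    HasSum (fun n : ℤ => (∫ x, fourier n x * u x ∂AddCircle.haarAddCircle) * fourierCoeff q n)
      (∫ x, q x * u x ∂AddCircle.haarAddCircle) := by
  let ubar : C(AddCircle T, ℂ) := ⟨fun x => star (u x), by fun_prop⟩
  let U : Lp ℂ 2 (AddCircle.haarAddCircle (T := T)) :=
    ContinuousMap.toLp 2 AddCircle.haarAddCircle ℂ ubar
  have inner_U (v : Lp ℂ 2 (AddCircle.haarAddCircle (T := T))) :
      inner ℂ U v = ∫ x, v x * u x ∂AddCircle.haarAddCircle := by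
    rw [L2.inner_def]
    refine integral_congr_ae ?_
    filter_upwards [ContinuousMap.coeFn_toLp (p := 2) (𝕜 := ℂ) AddCircle.haarAddCircle ubar]
      with x hx
    rw [hx]
    simp [ubar]
  have inner_U_fourierBasis (n : ℤ) :
      inner ℂ U (fourierBasis n) = ∫ x, fourier n x * u x ∂AddCircle.haarAddCircle := by
    rw [inner_U, coe_fourierBasis]
    refine integral_congr_ae ?_
    filter_upwards [coeFn_fourierLp (T := T) 2 n] with x hx
    rw [hx]
  simpa only [inner_U q, inner_U_fourierBasis, ← HilbertBasis.repr_apply_apply, fourierBasis_repr]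
    using (fourierBasis (T := T)).hasSum_inner_mul_inner U q

end Circle

theorem hasDerivAt_fourier_two_pi (n : ℤ) (x : ℝ) :
    HasDerivAt (fun y : ℝ => (fourier n (y : Torus) : ℂ))
      (Complex.I * n * fourier n (x : Torus)) x := by
  convert hasDerivAt_fourier (2 * Real.pi) n x using 1
  push_cast
  field

theorem integral_fourier_mul_deriv {φ ψ : Torus → ℂ} (hφ : Continuous φ) (hψ : Continuous ψ)
    (h : ∀ x : ℝ, HasDerivAt (fun y : ℝ => φ (y : Torus)) (ψ (x : Torus)) x) (n : ℤ) :
    ∫ x, fourier n x * ψ x ∂AddCircle.haarAddCircle =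
      -(Complex.I * n * ∫ x, fourier n x * φ x ∂AddCircle.haarAddCircle) := by
  have integrable {u : Torus → ℂ} (hu : Continuous u) : Integrable u AddCircle.haarAddCircle :=
    hu.integrable_of_hasCompactSupport (HasCompactSupport.of_compactSpace _)
  have leibniz : ∫ x, (Complex.I * n * (fourier n x * φ x) + fourier n x * ψ x)
      ∂AddCircle.haarAddCircle = 0 :=
    integral_deriv_eq_zero (χ := fun x => fourier n x * φ x) (by fun_prop) fun x =>
      ((hasDerivAt_fourier_two_pi n x).mul (h x)).congr_deriv (by ring)
  rw [integral_add (integrable (by fun_prop)) (integrable (by fun_prop)),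
    integral_const_mul] at leibniz
  linear_combination leibniz

theorem isWeakDeriv_iff {f g : L2T} :
    IsWeakDeriv f g ↔ ∀ n : ℤ, fourierCoeff g n = Complex.I * n * fourierCoeff f n := by
  refine ⟨fun h n => h.fourierCoeff_eq n, fun h φ ψ hφ_smooth hφψ => ?_⟩
  have hφ : Continuous φ := continuous_of_continuous_coe hφ_smooth.continuous
  have hψ : Continuous ψ := continuous_of_continuous_coe <|
    (hφ_smooth.continuous_deriv (by simp)).congr fun x => (hφψ x).deriv
  refine (hasSum_integral_fourier_mul_fourierCoeff hψ f).unique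
    ((hasSum_integral_fourier_mul_fourierCoeff hφ g).neg.congr_fun fun n => ?_)
  rw [integral_fourier_mul_deriv hφ hψ hφψ, h n]
  ring

theorem norm_I_mul_intCast_mul (n : ℤ) (z : ℂ) : ‖Complex.I * n * z‖ = |(n : ℝ)| * ‖z‖ := by
  rw [norm_mul, norm_mul, Complex.norm_I, one_mul, Complex.norm_intCast]

theorem memH_iff (k : ℕ) (f : L2T) :
    MemH k f ↔ Summable fun n : ℤ => (|(n : ℝ)| ^ k * ‖fourierCoeff f n‖) ^ 2 := by
  induction k generalizing f with
  | zero =>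
    simpa only [MemH, true_iff, pow_zero, one_mul, fourierBasis_repr] using
      (hasSum_sq_norm_repr fourierBasis f).summable
  | succ k ih =>
    constructor
    · rintro ⟨g, hg, hk⟩
      simpa only [hg.fourierCoeff_eq, norm_I_mul_intCast_mul, ← mul_assoc, ← pow_succ] using
        (ih g).1 hk
    · intro h
      have hsum : Summable fun n : ℤ => ‖Complex.I * n * fourierCoeff f n‖ ^ 2 := by
        refine h.of_nonneg_of_le (fun n => by positivity) fun n => ?_
        have hle : |(n : ℝ)| ≤ |(n : ℝ)| ^ (k + 1) := by
          rw [← Int.cast_abs, ← Int.natCast_natAbs]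
          exact_mod_cast Nat.le_self_pow k.succ_ne_zero _
        rw [norm_I_mul_intCast_mul]
        gcongr
      obtain ⟨g, hg⟩ := exists_repr_eq (fourierBasis (T := 2 * Real.pi)) hsum
      simp only [fourierBasis_repr] at hg
      refine ⟨g, isWeakDeriv_iff.2 hg, (ih g).2 ?_⟩
      simpa only [hg, norm_I_mul_intCast_mul, ← mul_assoc, ← pow_succ] using h

theorem MemH.fourierCoeff_weakDeriv {k : ℕ} {f : L2T} (h : MemH (k + 1) f) (n : ℤ) :
    fourierCoeff (weakDeriv f) n = Complex.I * n * fourierCoeff f n := by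
  obtain ⟨g, hg, -⟩ := h
  rw [hg.weakDeriv_eq, hg.fourierCoeff_eq]

theorem MemH.weakDeriv {k : ℕ} {f : L2T} (h : MemH (k + 1) f) : MemH k (weakDeriv f) := by
  obtain ⟨g, hg, hk⟩ := h
  rwa [hg.weakDeriv_eq]

theorem coeff_fourierBasis_apply {ι : Type*} (n : ℤ) (f : ι → L2T) (i : ι) :
    coeff fourierBasis n f i = fourierCoeff (f i) n := by
  rw [coeff_apply, fourierBasis_repr]

theorem memH_truncation {ι : Type*} (k : ℕ) (s : Finset ℤ) (f : ι → L2T) (i : ι) :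
    MemH k (truncation fourierBasis s f i) := by
  refine (memH_iff k _).2 (summable_of_ne_finset_zero (s := s) fun n hn => ?_)
  rw [← coeff_fourierBasis_apply, coeff_truncation, if_neg hn]
  simp

/-! ### The operator of the parabolic-transport system -/

section Operator

variable {dh dp : ℕ} {A B K : Matrix (Fin dh ⊕ Fin dp) (Fin dh ⊕ Fin dp) ℝ}
  {D : Matrix (Fin dp) (Fin dp) ℝ}

theorem fourierCoeff_neg_opL (f : State dh dp) (i : Fin dh ⊕ Fin dp) (n : ℤ) :
    fourierCoeff (-opL A B K f i) n =
      ∑ j, (B i j : ℂ) * fourierCoeff (weakDeriv (weakDeriv (f j))) n -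
        ∑ j, (A i j : ℂ) * fourierCoeff (weakDeriv (f j)) n -
        ∑ j, (K i j : ℂ) * fourierCoeff (f j) n := by
  have inner_fourierBasis (v : L2T) : inner ℂ (fourierBasis n) v = fourierCoeff v n := by
    rw [← HilbertBasis.repr_apply_apply, fourierBasis_repr]
  simp only [opL, ← inner_fourierBasis, inner_neg_right, inner_add_right, inner_sum,
    inner_smul_right_eq_smul, Complex.real_smul]
  ring

theorem coeff_neg_opL (hB : ∀ i j, B i (Sum.inl j) = 0) {f : State dh dp}
    (hf : f ∈ sobolev dh dp 1 2) (n : ℤ) :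
    coeff fourierBasis n (-opL A B K f) =
      symbol (complexAction A) (complexAction B) (complexAction K) n (coeff fourierBasis n f) := by
  have first_order (j : Fin dh ⊕ Fin dp) :
      fourierCoeff (weakDeriv (f j)) n = Complex.I * n * fourierCoeff (f j) n :=
    j.rec (fun j => (hf.1 j).fourierCoeff_weakDeriv n) fun j => (hf.2 j).fourierCoeff_weakDeriv n
  have second_order (i j : Fin dh ⊕ Fin dp) :
      (B i j : ℂ) * fourierCoeff (weakDeriv (weakDeriv (f j))) n =
        (B i j : ℂ) * (-(n : ℂ) ^ 2 * fourierCoeff (f j) n) := by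
    rcases j with j | j
    · rw [hB, Complex.ofReal_zero, zero_mul, zero_mul]
    · rw [(hf.2 j).weakDeriv.fourierCoeff_weakDeriv n, first_order]
      linear_combination (B i (Sum.inr j) : ℂ) * (n : ℂ) ^ 2 * fourierCoeff (f (Sum.inr j)) n
        * Complex.I_sq
  ext i
  rw [coeff_fourierBasis_apply, Pi.neg_apply, fourierCoeff_neg_opL, symbol_apply]
  simp only [first_order, second_order, complexAction_apply, Pi.neg_apply, Pi.add_apply,
    Pi.smul_apply, Matrix.mulVec, dotProduct, Matrix.map_apply, coeff_fourierBasis_apply,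
    Complex.coe_algebraMap, smul_eq_mul, Finset.mul_sum, ← Finset.sum_add_distrib,
    ← Finset.sum_sub_distrib, ← Finset.sum_neg_distrib]
  exact Finset.sum_congr rfl fun j _ => by ring

theorem closure_negLGraph (hB : ∀ i j, B i (Sum.inl j) = 0) :
    closure (negLGraph A B K) = symbolGraph fourierBasis
      (symbol (complexAction A) (complexAction B) (complexAction K)) := by
  apply Set.Subset.antisymm
  · refine closure_minimal ?_ isClosed_symbolGraph
    rintro ⟨f, g⟩ ⟨hf, rfl : g = -opL A B K f⟩ n
    exact coeff_neg_opL hB hf n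
  · rintro ⟨f, g⟩ h
    refine mem_closure_of_tendsto
      ((tendsto_truncation fourierBasis f).prodMk_nhds (tendsto_truncation fourierBasis g))
      (Eventually.of_forall fun s => ?_)
    have hs : truncation fourierBasis s f ∈ sobolev dh dp 1 2 :=
      ⟨fun i => memH_truncation 1 s f _, fun j => memH_truncation 2 s f _⟩
    refine ⟨hs, ext_coeff fourierBasis fun n => ?_⟩
    rw [coeff_neg_opL hB hs, coeff_truncation, coeff_truncation]
    split_ifs with hn
    · exact h n
    · rw [map_zero]

end Operator

section FreeSemigroup

variable {dh dp : ℕ} {A B K : Matrix (Fin dh ⊕ Fin dp) (Fin dh ⊕ Fin dp) ℝ}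

theorem existsUnique_isFreeSemigroup (hB : ∀ i j, B i (Sum.inl j) = 0)
    (h : UniformlyBoundedFlow (symbol (complexAction A) (complexAction B) (complexAction K))) :
    ∃! S, IsFreeSemigroup A B K S := by
  simp only [IsFreeSemigroup, closure_negLGraph hB]
  exact existsUnique_isC0Semigroup_of_symbol fourierBasis h

theorem IsFreeSemigroup.coeff_apply {S : ℝ≥0 → State dh dp →L[ℂ] State dh dp}
    (hS : IsFreeSemigroup A B K S) (hB : ∀ i j, B i (Sum.inl j) = 0) (t : ℝ≥0) (n : ℤ)
    (f : State dh dp) :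
    coeff fourierBasis n (S t f) =
      flow (symbol (complexAction A) (complexAction B) (complexAction K) n) t
        (coeff fourierBasis n f) :=
  hS.1.coeff_apply (hS.2.trans (closure_negLGraph hB)) t n f

theorem summable_sq_pow_mul_norm_coeff {ι E : Type*} [Finite ι] [SeminormedAddCommGroup E]
    [NormedSpace ℂ E] (L : (ι → ℂ) →L[ℂ] E) {k : ℕ} {f : ι → L2T} (hf : ∀ i, MemH k (f i)) :
    Summable fun n : ℤ => (|(n : ℝ)| ^ k * ‖L (coeff fourierBasis n f)‖) ^ 2 :=
  summable_sq_mul_norm_map L fun i => by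
    simpa only [coeff_fourierBasis_apply] using (memH_iff k (f i)).1 (hf i)

theorem memH_of_eventually_le {ι : Type*} [Fintype ι] {k : ℕ} {g : ι → L2T} {a : ℤ → ℝ}
    (ha : Summable fun n => a n ^ 2)
    (h : ∀ᶠ n : ℤ in cofinite, |(n : ℝ)| ^ k * ‖coeff fourierBasis n g‖ ≤ a n) (i : ι) :
    MemH k (g i) := by
  refine (memH_iff k _).2 (ha.of_norm_bounded_eventually ?_)
  filter_upwards [h] with n hn
  rw [Real.norm_of_nonneg (by positivity), ← coeff_fourierBasis_apply]
  gcongr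
  exact (mul_le_mul_of_nonneg_left (norm_le_pi_norm _ i) (by positivity)).trans hn

theorem IsFreeSemigroup.apply_mem_sobolev {S : ℝ≥0 → State dh dp →L[ℂ] State dh dp}
    (hS : IsFreeSemigroup A B K S) (hB : ∀ i j, B i (Sum.inl j) = 0) {E F : Type*}
    [NormedAddCommGroup E] [InnerProductSpace ℂ E] [NormedAddCommGroup F] [InnerProductSpace ℂ F]
    {eh : (Fin dh → ℂ) →L[ℂ] E} {ep : (Fin dp → ℂ) →L[ℂ] F} {c : ℝ} {β M : ℝ≥0}
    (H : IsAdapted (complexAction A) (complexAction B) (eh.comp (Pi.compRightL ℂ _ Sum.inl))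
      (ep.comp (Pi.compRightL ℂ _ Sum.inr)) c β M) {k : ℕ} (hk : IsSmoothingGain β k)
    {f : State dh dp} (hf : f ∈ sobolev dh dp k 0) {t : ℝ≥0} (ht : 0 < t) :
    S t f ∈ sobolev dh dp k k := by
  obtain ⟨C, hC⟩ := H.exists_pow_mul_norm_flow_symbol_le (complexAction K) hk
    (NNReal.coe_pos.2 ht)
  have summable_hyperbolic := summable_sq_pow_mul_norm_coeff eh hf.1
  have summable_parabolic := summable_sq_pow_mul_norm_coeff ep hf.2
  simp only [pow_zero, one_mul] at summable_parabolic
  have hmem (i) : MemH k (S t f i) := by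
    refine memH_of_eventually_le
      (a := fun n : ℤ => C * (|(n : ℝ)| ^ k * ‖eh (coeff fourierBasis n (f ∘ Sum.inl))‖ +
        ‖ep (coeff fourierBasis n (f ∘ Sum.inr))‖)) ?_ ?_ i
    · refine (((summable_hyperbolic.add summable_parabolic).mul_left
        (C ^ 2 * 2))).of_nonneg_of_le (fun n => by positivity) fun n => ?_
      rw [mul_pow, mul_assoc]
      gcongr
      exact add_sq_le
    · filter_upwards [hC] with n hn
      rw [hS.coeff_apply hB]
      exact hn (coeff fourierBasis n f)
  exact ⟨fun i => hmem _, fun j => hmem _⟩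

end FreeSemigroup

end ParabolicTransport

end

theorem mainTheorem11 (dh dp : ℕ) (hdh : 1 ≤ dh) (hdp : 1 ≤ dp)
    (A B K : Matrix (Fin dh ⊕ Fin dp) (Fin dh ⊕ Fin dp) ℝ)
    (D : Matrix (Fin dp) (Fin dp) ℝ)
    (hB : B = Matrix.fromBlocks 0 0 0 D)
    (hD : ∀ μ ∈ spectrum ℂ (ParabolicTransport.toComplex D), 0 < μ.re)
    (hA : ParabolicTransport.IsDiagonalizable (ParabolicTransport.toComplex A.toBlocks₁₁))
    (hA_real : ∀ μ ∈ spectrum ℂ (ParabolicTransport.toComplex A.toBlocks₁₁), μ.im = 0) :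
    (∃! S, ParabolicTransport.IsFreeSemigroup A B K S) ∧
    ∀ S, ParabolicTransport.IsFreeSemigroup A B K S →
      (∀ f₀ ∈ ParabolicTransport.sobolev dh dp 1 0, ∀ t : ℝ≥0, 0 < t →
        S t f₀ ∈ ParabolicTransport.sobolev dh dp 1 1) ∧
      (A.toBlocks₁₂ = 0 → ∀ f₀ ∈ ParabolicTransport.sobolev dh dp 2 0, ∀ t : ℝ≥0, 0 < t →
        S t f₀ ∈ ParabolicTransport.sobolev dh dp 2 2) := by
  subst hB
  obtain ⟨eh, ep, c, β, M, H, hβ⟩ := ParabolicTransport.exists_isAdapted A D hD hA hA_real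
  have hB (i : Fin dh ⊕ Fin dp) (j : Fin dh) :
      Matrix.fromBlocks 0 0 0 D i (Sum.inl j) = 0 := by
    cases i <;> rfl
  exact ⟨ParabolicTransport.existsUnique_isFreeSemigroup hB (H.uniformlyBoundedFlow _),
    fun S hS =>
      ⟨fun f₀ hf₀ t ht => hS.apply_mem_sobolev hB H (Or.inl rfl) hf₀ ht,
        fun hA₁₂ f₀ hf₀ t ht => hS.apply_mem_sobolev hB H (Or.inr ⟨rfl, hβ hA₁₂⟩) hf₀ ht⟩⟩
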